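/- **Setting.** Let $X$ be a non-empty metric space that is Gromov hyperbolic: for some $\delta$, $(x|y)_w\ge\min\{(x|z)_w,(z|y)_w\}-\delta$ for all $w,x,y,z\in X$, where $(x|y)_w=\frac12\bigl(d(x,w)+d(y,w)-d(x,y)\bigr)$. (This includes every hyperbolic complex, that is, every Gromov hyperbolic connected simplicial complex with its path metric in which all simplices are regular of edge length $1$.) Let $\partial X$ be the Gromov boundary of $X$ with the Gromov topology, let $\Delta\subset\partial X\times\partial X$ be the diagonal, and let $\partial^2X$ be the space of two point subsets of $\partial X$ with the quotient topology from $\partial X\times\partial X-\Delta$. Let a group $\Gamma$ act on $X$ by isometries, hence on $\partial X$, on $\partial X\times\partial X-\Delta$ and on $\partial^2X$. Stabilizers are taken in $\Gamma$. An element $h\in\Gamma$ is *loxodromic* if for each $x\in X$ the map $\mathbb Z\to X$, $i\mapsto h^i(x)$, is a quasi-isometric embedding. Then $\partial_+h,\partial_-h\in\partial X$ are the limits of $h^i(x)$ as $i\to+\infty$ and as $i\to-\infty$. Write $\partial_\pm h=(\partial_-h,\partial_+h)$ for the ordered pair and $\partial h=\{\partial_-h,\partial_+h\}$ for the unordered pair.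 Two loxodromic elements $g,h$ are *independent* if $\partial g\cap\partial h=\emptyset$. A *quasi-axis* of $h$ is a quasi-isometric embedding $\gamma:\mathbb R\to X$ such that, for some $T>0$, $\gamma(t+T)=h(\gamma(t))$ for all $t$; we also write $\ell$ for its image. The element $h$ *satisfies WWPD* if it is loxodromic and for every $x\in X$ and $R>0$ there is an integer $M\ge1$ such that every subset $Z\subset\Gamma$ with the following two properties is finite: $d(x,g(x))<R$ and $d(h^M(x),gh^M(x))<R$ for each $g\in Z$; and no two distinct elements of $Z$ lie in the same left coset of $\mathrm{Stab}(\partial_\pm h)$. **Proposition.** Let $h\in\Gamma$ be loxodromic. The following are equivalent. 1. $h$ satisfies WWPD. 2. $h$ has equivariantly discrete fixed set: the $\Gamma$-orbit of $\partial h$ is a discrete subset of $\partial^2X$; equivalently, the $\Gamma$-orbit of $\partial_\pm h$ is a discrete subset of $\partial X\times\partial X-\Delta$. (Both forms belong to the list of equivalent conditions.) 3. For every quasi-axis $\ell$ of $h$ there is $D\ge0$ such that for every $g\in\Gamma$ with $g\notin\mathrm{Stab}(\partial h)$ the image of every closest point map $g(\ell)\to\ell$ has diameter at most $D$. 4. There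 is no infinite sequence $g_1,g_2,g_3,\dots$ in $\Gamma$ such that (a) for all $i\ne j$ the elements $g_i,g_j$ lie in different left cosets of $\mathrm{Stab}(\partial_\pm h)$; and (b) for all $x\in X$ there is $R>0$ such that for all $M\ge0$ there is $I\ge0$ such that $d(g_ih^m(x),h^m(x))<R$ whenever $0\le m\le M$ and $i\ge I$. 5. The same as 4, with "for all $x\in X$" in (b) replaced by "for some $x\in X$". Furthermore, if $h$ satisfies WWPD, then * $\mathrm{Stab}(\partial_-h)=\mathrm{Stab}(\partial_+h)=\mathrm{Stab}(\partial_\pm h)$; and * for every $k\in\Gamma-\mathrm{Stab}(\partial h)$, the elements $h$ and $khk^{-1}$ are loxodromic and independent. -/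

import Mathlib

open Filter Topology
open scoped Pointwise

namespace WWPD

/-- The Gromov product of `x` and `y` based at `w`. -/
noncomputable def gromovProduct {X : Type*} [MetricSpace X] (w x y : X) : ℝ :=
  (dist x w + dist y w - dist x y) / 2

/-- Gromov hyperbolicity of a metric space. -/
class GromovHyperbolic (X : Type*) [MetricSpace X] : Prop where
  exists_delta : ∃ δ : ℝ, ∀ w x y z : X,
    min (gromovProduct w x z) (gromovProduct w z y) - δ ≤ gromovProduct w x y

/-- `f` is a quasi-isometric embedding (not necessarily continuous). -/
def IsQuasiIsometricEmbedding {A B : Type*} [PseudoMetricSpace A] [PseudoMetricSpace B]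
    (f : A → B) : Prop :=
  ∃ K C : ℝ, 1 ≤ K ∧ 0 ≤ C ∧ ∀ s t : A,
    dist s t / K - C ≤ dist (f s) (f t) ∧ dist (f s) (f t) ≤ K * dist s t + C

section Boundary

variable {X : Type*} [MetricSpace X]

lemma gromovProduct_comm (w x y : X) : gromovProduct w x y = gromovProduct w y x := by
  unfold gromovProduct
  rw [dist_comm x y]
  ring

lemma gromovProduct_le_base (w w' x y : X) :
    gromovProduct w x y ≤ gromovProduct w' x y + dist w w' := by
  unfold gromovProduct
  have h1 := dist_triangle_right x w w'
  have h2 := dist_triangle_right y w w'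
  linarith

/-- `(u_i | v_j) → ∞` as `i, j → ∞`, for every base point (equivalently, for one). -/
def Fellow (u v : ℕ → X) : Prop :=
  ∀ w : X, Tendsto (fun p : ℕ × ℕ => gromovProduct w (u p.1) (v p.2)) atTop atTop

lemma Fellow.symm {u v : ℕ → X} (h : Fellow u v) : Fellow v u := by
  intro w
  have hs : Tendsto (Prod.swap : ℕ × ℕ → ℕ × ℕ) atTop atTop := by
    rw [← prod_atTop_atTop_eq]
    exact tendsto_snd.prodMk tendsto_fst
  refine ((h w).comp hs).congr fun p => ?_
  exact gromovProduct_comm _ _ _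

lemma Fellow.trans [GromovHyperbolic X] {u v t : ℕ → X} (h : Fellow u v) (h' : Fellow v t) :
    Fellow u t := by
  obtain ⟨δ, hδ⟩ := GromovHyperbolic.exists_delta (X := X)
  intro w
  rw [tendsto_atTop]
  intro b
  obtain ⟨p, hp⟩ := eventually_atTop.1 (tendsto_atTop.1 (h w) (b + δ))
  obtain ⟨q, hq⟩ := eventually_atTop.1 (tendsto_atTop.1 (h' w) (b + δ))
  refine eventually_atTop.2 ⟨(p.1, q.2), fun r hr => ?_⟩
  have h1 := hp (r.1, max p.2 q.1) ⟨hr.1, le_max_left _ _⟩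
  have h2 := hq (max p.2 q.1, r.2) ⟨le_max_right _ _, hr.2⟩
  have h3 := hδ w (u r.1) (t r.2) (v (max p.2 q.1))
  have h4 := le_min h1 h2
  linarith

variable (X) in
/-- Sequences converging to infinity. -/
def SeqToInfinity : Type _ := {u : ℕ → X // Fellow u u}

variable (X) in
/-- Two sequences converging to infinity are equivalent if their mutual Gromov products
tend to infinity. -/
def boundarySetoid [GromovHyperbolic X] : Setoid (SeqToInfinity X) where
  r u v := Fellow u.1 v.1
  iseqv := ⟨fun u => u.2, Fellow.symm, Fellow.trans⟩

variable (X) in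
/-- The Gromov boundary of `X`. -/
def Boundary [GromovHyperbolic X] : Type _ := Quotient (boundarySetoid X)

/-- The boundary point represented by a sequence converging to infinity. -/
def Boundary.mk [GromovHyperbolic X] (u : ℕ → X) (hu : Fellow u u) : Boundary X :=
  Quotient.mk (boundarySetoid X) ⟨u, hu⟩

lemma Boundary.mk_eq_mk [GromovHyperbolic X] {u v : ℕ → X} {hu : Fellow u u} {hv : Fellow v v} :
    Boundary.mk u hu = Boundary.mk v hv ↔ Fellow u v :=
  Quotient.eq (r := boundarySetoid X)

/-- The basic neighbourhood of `ξ` consisting of the boundary points `η` such that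
`(u_i | v_j)_w ≥ r` for all large `i, j`, for some sequences `u → ξ` and `v → η`. -/
def Boundary.nhd [GromovHyperbolic X] (w : X) (ξ : Boundary X) (r : ℝ) : Set (Boundary X) :=
  {η | ∃ (u v : ℕ → X) (hu : Fellow u u) (hv : Fellow v v),
    Boundary.mk u hu = ξ ∧ Boundary.mk v hv = η ∧
      ∀ᶠ p : ℕ × ℕ in atTop, r ≤ gromovProduct w (u p.1) (v p.2)}

/-- The Gromov topology on the boundary: the sets `Boundary.nhd w ξ r`, `r ∈ ℝ`, are a basis of
(not necessarily open) neighbourhoods of `ξ`, whatever the base point `w`. -/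
instance [GromovHyperbolic X] : TopologicalSpace (Boundary X) where
  IsOpen U := ∀ ξ ∈ U, ∀ w : X, ∃ r : ℝ, Boundary.nhd w ξ r ⊆ U
  isOpen_univ := fun _ _ _ => ⟨0, Set.subset_univ _⟩
  isOpen_inter := by
    intro s t hs ht ξ hξ w
    obtain ⟨r, hr⟩ := hs ξ hξ.1 w
    obtain ⟨r', hr'⟩ := ht ξ hξ.2 w
    refine ⟨max r r', ?_⟩
    rintro η ⟨u, v, hu, hv, h1, h2, h3⟩
    exact ⟨hr ⟨u, v, hu, hv, h1, h2, h3.mono fun p hp => (le_max_left _ _).trans hp⟩,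
      hr' ⟨u, v, hu, hv, h1, h2, h3.mono fun p hp => (le_max_right _ _).trans hp⟩⟩
  isOpen_sUnion := by
    intro S hS ξ hξ w
    obtain ⟨s, hs, hξs⟩ := hξ
    obtain ⟨r, hr⟩ := hS s hs ξ hξs w
    exact ⟨r, hr.trans (Set.subset_sUnion_of_mem hs)⟩

variable (X) in
/-- The space `∂X × ∂X - Δ`, with the subspace topology. -/
abbrev OrderedPairs [GromovHyperbolic X] : Type _ :=
  {p : Boundary X × Boundary X // p.1 ≠ p.2}

variable (X) in
/-- The space `∂²X` of two point subsets of the boundary. -/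
def TwoPointSubsets [GromovHyperbolic X] : Type _ :=
  {s : Set (Boundary X) // ∃ ξ η : Boundary X, ξ ≠ η ∧ s = {ξ, η}}

/-- The map `∂X × ∂X - Δ → ∂²X` that forgets the order. -/
def OrderedPairs.forget [GromovHyperbolic X] (p : OrderedPairs X) : TwoPointSubsets X :=
  ⟨{p.1.1, p.1.2}, p.1.1, p.1.2, p.2, rfl⟩

/-- The quotient topology on `∂²X`. -/
instance [GromovHyperbolic X] : TopologicalSpace (TwoPointSubsets X) :=
  TopologicalSpace.coinduced OrderedPairs.forget inferInstance

end Boundary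

/-- Quasi-superadditivity of the displacements of the powers of a loxodromic isometry. -/
lemma quasi_superadditive {a : ℕ → ℝ} {δ K C : ℝ} (hδ : 0 ≤ δ) (hK : 1 ≤ K)
    (h0 : a 0 = 0) (hsub : ∀ m n, a (m + n) ≤ a m + a n) (hrev : ∀ m n, a m ≤ a (m + n) + a n)
    (hlow : ∀ n : ℕ, (n : ℝ) / K - C ≤ a n)
    (hfp : ∀ p q r, a (p + q) + a (q + r) ≤ max (a p + a r) (a q + a (p + q + r)) + 2 * δ) :
    ∃ D, ∀ i k, a i + a k - D ≤ a (i + k) := by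
  have hnn : ∀ n, 0 ≤ a n := fun n => by
    have := hrev 0 n
    rw [h0] at this
    have h2 := hrev n n
    have h3 := hsub 0 n
    rw [zero_add] at this
    linarith
  -- a step at which doubling gains a definite amount
  obtain ⟨N, hN, hNa⟩ : ∃ N : ℕ, 1 ≤ N ∧ a N + (3 * δ + 1) ≤ a (2 * N) := by
    by_contra! hcon
    have hb : ∀ k : ℕ, a (2 ^ k) ≤ a 1 + k * (3 * δ + 1) := by
      intro k
      induction k with
      | zero => simp
      | succ k ih =>
        have := hcon (2 ^ k) Nat.one_le_two_pow
        rw [pow_succ, mul_comm]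
        push_cast
        linarith
    have ht := tendsto_pow_const_div_const_pow_of_one_lt 1 (one_lt_two : (1 : ℝ) < 2)
    have ht2 : Tendsto (fun k : ℕ => (a 1 + C) * ((1 / 2 : ℝ) ^ k)
        + (3 * δ + 1) * ((k : ℝ) ^ 1 / 2 ^ k)) atTop (𝓝 0) := by
      have h1 := (tendsto_pow_atTop_nhds_zero_of_lt_one (r := (1 / 2 : ℝ))
        (by norm_num) (by norm_num)).const_mul (a 1 + C)
      simpa using h1.add (ht.const_mul (3 * δ + 1))
    have hKi : (0 : ℝ) < 1 / K := by positivity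
    obtain ⟨k, hk⟩ := (ht2.eventually (gt_mem_nhds hKi)).exists
    have h1 := hlow (2 ^ k)
    have h2 := hb k
    have h3 : (0 : ℝ) < 2 ^ k := by positivity
    have h4 : (a 1 + C) * ((1 / 2 : ℝ) ^ k) + (3 * δ + 1) * ((k : ℝ) ^ 1 / 2 ^ k)
        = (a 1 + C + k * (3 * δ + 1)) / 2 ^ k := by
      rw [one_div, inv_pow]
      field_simp
    rw [h4, div_lt_iff₀ h3] at hk
    push_cast at h1
    have h5 : 1 / K * 2 ^ k = 2 ^ k / K := by ring
    linarith
  -- the multiples of that step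
  have hstep : ∀ k : ℕ, a ((k + 1) * N) + (δ + 1) ≤ a ((k + 2) * N) := by
    intro k
    induction k with
    | zero =>
      have e1 : (0 + 1) * N = N := by ring
      have e2 : (0 + 2) * N = 2 * N := by ring
      rw [e1, e2]
      linarith
    | succ k ih =>
      have h := hfp ((k + 1) * N) N N
      have e1 : (k + 1) * N + N = (k + 2) * N := by ring
      have e2 : N + N = 2 * N := by ring
      have e3 : (k + 2) * N + N = (k + 1 + 2) * N := by ring
      have e4 : k + 1 + 1 = k + 2 := rfl
      rw [e1, e2, e3] at h
      rw [e4]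
      rcases le_total (a ((k + 1) * N) + a N) (a N + a ((k + 1 + 2) * N)) with h1 | h1
      · rw [max_eq_right h1] at h
        linarith
      · rw [max_eq_left h1] at h
        linarith
  have hc : ∀ i k : ℕ, a (i * N) + a (k * N) - (2 * a N + 2 * δ) ≤ a ((i + k) * N) := by
    intro i k
    have hN0 := hnn N
    rcases i with _ | i
    · rw [zero_mul, h0, zero_add, zero_add]
      linarith
    rcases k with _ | _ | k
    · rw [zero_mul, h0, add_zero, add_zero]
      linarith
    · have h := hrev ((i + 1) * N) N
      have e1 : (i + 1 + (0 + 1)) * N = (i + 1) * N + N := by ring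
      have e2 : (0 + 1) * N = N := by ring
      rw [e1, e2]
      linarith
    · have h := hfp ((i + 1) * N) N ((k + 1) * N)
      have e1 : (i + 1) * N + N = (i + 2) * N := by ring
      have e2 : N + (k + 1) * N = (k + 2) * N := by ring
      have e3 : (i + 2) * N + (k + 1) * N = (i + 1 + (k + 1 + 1)) * N := by ring
      have e4 : k + 1 + 1 = k + 2 := rfl
      rw [e1, e2, e3] at h
      rw [e4] at h ⊢
      have h1 := hstep i
      have h2 := hstep k
      rcases le_total (a ((i + 1) * N) + a ((k + 1) * N))
        (a N + a ((i + 1 + (k + 2)) * N)) with h3 | h3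
      · rw [max_eq_right h3] at h
        linarith
      · rw [max_eq_left h3] at h
        linarith
  set B := ∑ s ∈ Finset.range N, a s with hB
  have hBs : ∀ n, a (n % N) ≤ B := fun n =>
    Finset.single_le_sum (f := a) (fun i _ => hnn i) (Finset.mem_range.2 (Nat.mod_lt _ hN))
  have hdm : ∀ n : ℕ, n / N * N + n % N = n := fun n => Nat.div_add_mod' n N
  refine ⟨2 * a N + 2 * δ + 4 * B, fun i k => ?_⟩
  have hi := hsub (i / N * N) (i % N)
  have hk := hsub (k / N * N) (k % N)
  have hik := hrev ((i / N + k / N) * N) (i % N + k % N)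
  have e : (i / N + k / N) * N + (i % N + k % N) = i + k := by
    have h1 := hdm i
    have h2 := hdm k
    rw [add_mul]
    omega
  rw [hdm] at hi hk
  rw [e] at hik
  have h1 := hsub (i % N) (k % N)
  have h2 := hc (i / N) (k / N)
  have h3 := hBs i
  have h4 := hBs k
  linarith

section Action

variable {X : Type*} [MetricSpace X] {Γ : Type*} [Group Γ] [MulAction Γ X] [IsIsometricSMul Γ X]

lemma gromovProduct_smul (g : Γ) (w x y : X) :
    gromovProduct w (g • x) (g • y) = gromovProduct (g⁻¹ • w) x y := by
  unfold gromovProduct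
  have key : ∀ z : X, dist (g • z) w = dist z (g⁻¹ • w) := fun z => by
    rw [← dist_smul g z (g⁻¹ • w), smul_inv_smul]
  rw [dist_smul, key, key]

lemma Fellow.smul {u v : ℕ → X} (h : Fellow u v) (g : Γ) :
    Fellow (fun n => g • u n) (fun n => g • v n) := by
  intro w
  simp only [gromovProduct_smul]
  exact h (g⁻¹ • w)

/-- The action on the boundary induced by an isometric action: `g • [u] = [g • u]`. -/
instance [GromovHyperbolic X] : MulAction Γ (Boundary X) where
  smul g := Quotient.map' (s₁ := boundarySetoid X) (s₂ := boundarySetoid X)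
    (fun u => ⟨fun n => g • u.1 n, u.2.smul g⟩) (fun _ _ h => Fellow.smul h g)
  one_smul := by
    intro ξ
    induction ξ using Quotient.inductionOn with
    | h u =>
      refine Quotient.sound (s := boundarySetoid X) ?_
      change Fellow (fun n => (1 : Γ) • u.1 n) u.1
      simpa only [one_smul] using u.2
  mul_smul := by
    intro g g' ξ
    induction ξ using Quotient.inductionOn with
    | h u =>
      refine Quotient.sound (s := boundarySetoid X) ?_
      change Fellow (fun n => (g * g') • u.1 n) (fun n => g • g' • u.1 n)
      simpa only [mul_smul] using (u.2.smul g').smul g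

lemma Boundary.smul_mk [GromovHyperbolic X] (g : Γ) (u : ℕ → X) (hu : Fellow u u) :
    g • Boundary.mk u hu = Boundary.mk (fun n => g • u n) (hu.smul g) := rfl

variable (X) in
/-- `h` is loxodromic: every orbit map `ℤ → X` is a quasi-isometric embedding. -/
def IsLoxodromic (h : Γ) : Prop :=
  ∀ x : X, IsQuasiIsometricEmbedding (fun n : ℤ => h ^ n • x)

/-- The forward orbit of a loxodromic element converges to infinity. -/
lemma IsLoxodromic.fellow [GromovHyperbolic X] {h : Γ} (hh : IsLoxodromic X h) (x : X) :
    Fellow (fun n : ℕ => h ^ n • x) (fun n : ℕ => h ^ n • x) := by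
  obtain ⟨δ', hδ'⟩ := GromovHyperbolic.exists_delta (X := X)
  obtain ⟨K, C, hK, -, hQ⟩ := hh x
  set δ := max δ' 0 with hδ_def
  set a : ℕ → ℝ := fun n => dist x (h ^ n • x) with ha
  have hd : ∀ i k : ℕ, dist (h ^ i • x) (h ^ (i + k) • x) = a k := fun i k => by
    rw [pow_add, mul_smul, dist_smul]
  have hd' : ∀ i k : ℕ, dist (h ^ (i + k) • x) (h ^ i • x) = a k := fun i k => by
    rw [dist_comm, hd]
  have hlow : ∀ n : ℕ, (n : ℝ) / K - C ≤ a n := fun n => by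
    have := (hQ 0 n).1
    dsimp only at this
    rw [zpow_zero, one_smul, zpow_natCast, Int.dist_eq] at this
    simpa using this
  have hsub : ∀ m n, a (m + n) ≤ a m + a n := fun m n => by
    have := dist_triangle x (h ^ m • x) (h ^ (m + n) • x)
    rwa [hd] at this
  have hrev : ∀ m n, a m ≤ a (m + n) + a n := fun m n => by
    have := dist_triangle x (h ^ (m + n) • x) (h ^ m • x)
    rwa [hd'] at this
  have hfp : ∀ p q r,
      a (p + q) + a (q + r) ≤ max (a p + a r) (a q + a (p + q + r)) + 2 * δ := fun p q r => by
    have h1 := hδ' x (h ^ p • x) (h ^ (p + q + r) • x) (h ^ (p + q) • x)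
    have h1' := le_max_left δ' 0
    unfold gromovProduct at h1
    have e1 : dist (h ^ p • x) x = a p := dist_comm _ _
    have e2 : dist (h ^ (p + q) • x) x = a (p + q) := dist_comm _ _
    have e3 : dist (h ^ (p + q + r) • x) x = a (p + q + r) := dist_comm _ _
    have e4 : dist (h ^ p • x) (h ^ (p + q + r) • x) = a (q + r) := by rw [add_assoc, hd]
    rw [e1, e2, e3, e4, hd p q, hd (p + q) r] at h1
    rcases le_total ((a p + a (p + q) - a q) / 2) ((a (p + q) + a (p + q + r) - a r) / 2)
      with h2 | h2
    · rw [min_eq_left h2] at h1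
      have h3 := le_max_right (a p + a r) (a q + a (p + q + r))
      linarith
    · rw [min_eq_right h2] at h1
      have h3 := le_max_left (a p + a r) (a q + a (p + q + r))
      linarith
  obtain ⟨D, hD⟩ := quasi_superadditive (le_max_right δ' 0) hK (by simp [ha]) hsub hrev hlow hfp
  have hgp : ∀ i k : ℕ, a i - D / 2 ≤ gromovProduct x (h ^ i • x) (h ^ (i + k) • x) := by
    intro i k
    unfold gromovProduct
    rw [hd, dist_comm _ x, dist_comm _ x]
    have := hD i k
    change a i - D / 2 ≤ (a i + a (i + k) - a k) / 2
    linarith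
  intro w
  rw [tendsto_atTop]
  intro b
  have hK0 : 0 < K := by linarith
  obtain ⟨n, hn⟩ := exists_nat_ge ((b + dist x w + D / 2 + C) * K)
  refine eventually_atTop.2 ⟨(n, n), ?_⟩
  rintro ⟨i, j⟩ ⟨hi, hj⟩
  have hbig : ∀ m : ℕ, n ≤ m → b + dist x w ≤ a m - D / 2 := fun m hm => by
    have h1 : (n : ℝ) ≤ m := by exact_mod_cast hm
    have h2 : b + dist x w + D / 2 + C ≤ m / K := by
      rw [le_div_iff₀ hK0]
      linarith
    have h3 := hlow m
    linarith
  have hbase := gromovProduct_le_base x w (h ^ i • x) (h ^ j • x)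
  dsimp only at hi hj ⊢
  rcases le_total i j with hij | hij
  · obtain ⟨k, rfl⟩ := Nat.exists_eq_add_of_le hij
    have h1 := hgp i k
    have h2 := hbig i hi
    linarith
  · obtain ⟨k, rfl⟩ := Nat.exists_eq_add_of_le hij
    have h1 := hgp j k
    have h2 := hbig j hj
    rw [gromovProduct_comm] at h1
    linarith

set_option linter.unusedSectionVars false in
lemma IsLoxodromic.inv {h : Γ} (hh : IsLoxodromic X h) : IsLoxodromic X h⁻¹ := by
  intro x
  obtain ⟨K, C, hK, hC, hQ⟩ := hh x
  refine ⟨K, C, hK, hC, fun s t => ?_⟩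
  have := hQ (-s) (-t)
  rw [dist_neg_neg] at this
  simpa only [inv_zpow, zpow_neg] using this

variable [GromovHyperbolic X] [Nonempty X]

/-- The attracting fixed point `∂₊h`, the limit of `hⁿ x` as `n → ∞`. -/
noncomputable def IsLoxodromic.attractor {h : Γ} (hh : IsLoxodromic X h) : Boundary X :=
  Boundary.mk (fun n : ℕ => h ^ n • Classical.arbitrary X) (hh.fellow _)

/-- The repelling fixed point `∂₋h`, the limit of `h⁻ⁿ x` as `n → ∞`. -/
noncomputable def IsLoxodromic.repeller {h : Γ} (hh : IsLoxodromic X h) : Boundary X :=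
  hh.inv.attractor

/-- The attracting fixed point does not depend on the orbit. -/
lemma IsLoxodromic.attractor_eq {h : Γ} (hh : IsLoxodromic X h) (x : X) :
    hh.attractor = Boundary.mk (fun n : ℕ => h ^ n • x) (hh.fellow x) := by
  refine Boundary.mk_eq_mk.2 fun w => ?_
  have h1 := hh.fellow x w
  refine tendsto_atTop_mono ?_ (tendsto_atTop_add_const_right _
    (-dist x (Classical.arbitrary X)) h1)
  rintro ⟨i, j⟩
  unfold gromovProduct
  have e := dist_smul (h ^ i) x (Classical.arbitrary X)
  have t1 := dist_triangle (h ^ i • x) (h ^ i • Classical.arbitrary X) w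
  have t2 := dist_triangle_left (h ^ i • Classical.arbitrary X) (h ^ j • x) (h ^ i • x)
  dsimp only
  linarith

/-- The ordered pair `∂_±h = (∂₋h, ∂₊h)`. -/
noncomputable def IsLoxodromic.endpointPair {h : Γ} (hh : IsLoxodromic X h) :
    Boundary X × Boundary X :=
  (hh.repeller, hh.attractor)

/-- The unordered pair `∂h = {∂₋h, ∂₊h}`. -/
noncomputable def IsLoxodromic.endpoints {h : Γ} (hh : IsLoxodromic X h) : Set (Boundary X) :=
  {hh.repeller, hh.attractor}

/-- The `Γ`-orbit of `∂h` is a discrete subset of `∂²X`. -/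
def IsLoxodromic.HasEquivariantlyDiscreteFixedSet {h : Γ} (hh : IsLoxodromic X h) : Prop :=
  IsDiscrete {s : TwoPointSubsets X | s.1 ∈ MulAction.orbit Γ hh.endpoints}

/-- The `Γ`-orbit of `∂_±h` is a discrete subset of `∂X × ∂X - Δ`. -/
def IsLoxodromic.HasEquivariantlyDiscreteFixedPair {h : Γ} (hh : IsLoxodromic X h) : Prop :=
  IsDiscrete {p : OrderedPairs X | p.1 ∈ MulAction.orbit Γ hh.endpointPair}

/-- `g` and `g'` lie in the same left coset of `Stab(∂_±h)`. -/
def IsLoxodromic.SameCoset {h : Γ} (hh : IsLoxodromic X h) (g g' : Γ) : Prop :=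
  (g : Γ ⧸ MulAction.stabilizer Γ hh.endpointPair) = g'

variable (X) in
/-- The WWPD property. -/
def IsWWPD (h : Γ) : Prop :=
  ∃ hh : IsLoxodromic X h, ∀ x : X, ∀ R > (0 : ℝ), ∃ M : ℕ, 1 ≤ M ∧ ∀ Z : Set Γ,
    (∀ g ∈ Z, dist x (g • x) < R ∧ dist (h ^ M • x) (g • h ^ M • x) < R) →
    (∀ g ∈ Z, ∀ g' ∈ Z, g ≠ g' → ¬ hh.SameCoset g g') →
    Z.Finite

/-- `γ` is a quasi-axis of `h`. -/
def IsQuasiAxis (h : Γ) (γ : ℝ → X) : Prop :=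
  IsQuasiIsometricEmbedding γ ∧ ∃ T > (0 : ℝ), ∀ t, γ (t + T) = h • γ t

/-- `π` restricts to a closest point map from `A` to `B`. -/
def IsClosestPointMap (A B : Set X) (π : X → X) : Prop :=
  ∀ y ∈ A, π y ∈ B ∧ ∀ p ∈ B, dist y (π y) ≤ dist y p

/-- For every quasi-axis `ℓ` of `h`, the closest point maps from `g(ℓ)` to `ℓ`, where `g` does
not stabilize the unordered pair `∂h`, have images of uniformly bounded diameter. -/
def IsLoxodromic.HasBoundedProjections {h : Γ} (hh : IsLoxodromic X h) : Prop :=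
  ∀ γ : ℝ → X, IsQuasiAxis h γ → ∃ D : ℝ, 0 ≤ D ∧
    ∀ g : Γ, g ∉ MulAction.stabilizer Γ hh.endpoints →
      ∀ π : X → X, IsClosestPointMap (g • Set.range γ) (Set.range γ) π →
        ∀ y ∈ g • Set.range γ, ∀ y' ∈ g • Set.range γ, dist (π y) (π y') ≤ D

/-- The elements `g i` move longer and longer initial segments of the ray `hᵐ x`, `m ≥ 0`, by a
bounded amount. -/
def MovesRayBoundedly (h : Γ) (g : ℕ → Γ) (x : X) : Prop :=
  ∃ R > (0 : ℝ), ∀ M : ℕ, ∃ I : ℕ, ∀ m i : ℕ, m ≤ M → I ≤ i →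
    dist (g i • h ^ m • x) (h ^ m • x) < R

variable (X) in
/-- Two group elements are independent loxodromics. -/
def Independent (g h : Γ) : Prop :=
  ∃ (hg : IsLoxodromic X g) (hh : IsLoxodromic X h), hg.endpoints ∩ hh.endpoints = ∅

end Action

end WWPD

/-! An orbit `n ↦ h ^ n • x` is more than a quasi-geodesic: its displacement is subadditive and, by
hyperbolicity, superadditive up to a constant, so distances along it equal `τ|m - n|` up to a
bounded error (`IsLoxodromic.exists_isRoughLine`). For such rough lines the four-point inequality
replaces the Morse lemma, and neither geodesics nor properness of `X` is needed. Two rough lines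
close at two parameters are close in between (`dist_le_of_mem`), and large Gromov products of their
ends amount to fellow travelling on long initial segments. Neighbourhoods of `∂₋h` and `∂₊h` thus
translate into overlaps of orbits.

The implications form two cycles in the numbering of the list in `mainTheorem6`, 1 → 6 → 5 → 1 and 6
→ 3 → 2 → 4 → 6. If the ordered pair is not isolated, some `g` nearly fixes both ends without fixing
both; then `g` carries the orbit along itself for a long time, and multiplying `g` by a power of
`h`, which keeps the coset, aligns the parameters (6 → 3). Isolation of the ordered pair gives that
of the unordered one because at most one orbit point can lie near the swapped pair (3 → 2). A large
projection of `g(ℓ)` forces a long overlap with `ℓ`; recentred by powers of `h`, `g` nearly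
preserves `∂h`, so preserves it (2 → 4). Conversely, elements moving a long segment boundedly have
large projections, and only two cosets lie in `Stab(∂h)` (4 → 6).

For the final claims, an element sending one endpoint to an endpoint makes two rays asymptotic;
recentring far out along them gives arbitrarily long overlaps with a fixed error, so isolation
applies again. -/

namespace WWPD

/-- A quasi-additive sequence with linear growth is within bounded distance of `n ↦ τ * n`. -/
lemma exists_linear_growth {a : ℕ → ℝ} {D K C : ℝ} (hK : 1 ≤ K) (h0 : a 0 = 0)
    (hsub : ∀ m n, a (m + n) ≤ a m + a n) (hnn : ∀ n, 0 ≤ a n)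
    (hlow : ∀ n : ℕ, (n : ℝ) / K - C ≤ a n)
    (hsup : ∀ i k, a i + a k - D ≤ a (i + k)) :
    ∃ τ > 0, ∀ n : ℕ, τ * n ≤ a n ∧ a n ≤ τ * n + D := by
  have hD : 0 ≤ D := by
    have := hsup 0 0
    rw [add_zero, h0, add_zero] at this
    linarith
  have ha : Subadditive a := hsub
  have hbdd : BddBelow (Set.range fun n => a n / n) :=
    ⟨0, by rintro _ ⟨n, rfl⟩; exact div_nonneg (hnn n) n.cast_nonneg⟩
  have hub : ∀ n : ℕ, a n ≤ n * a 1 := by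
    intro n
    induction n with
    | zero => simp [h0]
    | succ n ih =>
      have := hsub n 1
      push_cast
      linarith
  -- Fekete's lemma applies to both `a` and `D - a`. Each limit is the infimum of the quotients and
  -- the two are opposite, which gives the two bounds with the same slope.
  have hu : Subadditive fun n => D - a n := fun m n => by
    have := hsup m n
    linarith
  have hubdd : BddBelow (Set.range fun n : ℕ => (D - a n) / n) := by
    refine ⟨-a 1, ?_⟩
    rintro _ ⟨n, rfl⟩
    have h1 := hnn 1
    rcases Nat.eq_zero_or_pos n with rfl | hn
    · simpa using h1
    · have hn' : (0 : ℝ) < n := by exact_mod_cast hn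
      dsimp only
      rw [le_div_iff₀ hn']
      have := hub n
      linarith
  have hlim := ha.tendsto_lim hbdd
  have hulim := hu.tendsto_lim hubdd
  have hsum := (hlim.add hulim)
  have hz : Tendsto (fun n : ℕ => D / n) atTop (𝓝 0) := tendsto_const_div_atTop_nhds_zero_nat D
  have heq : ha.lim + hu.lim = 0 := by
    refine tendsto_nhds_unique (hsum.congr fun n => ?_) hz
    rw [← add_div, add_sub_cancel]
  have hbound : ∀ n : ℕ, ha.lim * n ≤ a n ∧ a n ≤ ha.lim * n + D := by
    intro n
    rcases Nat.eq_zero_or_pos n with rfl | hn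
    · simp [h0, hD]
    · have hn' : (0 : ℝ) < n := by exact_mod_cast hn
      have h1 := ha.lim_le_div hbdd hn.ne'
      have h2 := hu.lim_le_div hubdd hn.ne'
      rw [le_div_iff₀ hn'] at h1 h2
      refine ⟨h1, ?_⟩
      have h3 : hu.lim = -ha.lim := by linarith
      rw [h3] at h2
      linarith
  refine ⟨ha.lim, ?_, hbound⟩
  have hKi : 0 < 1 / K := by positivity
  by_contra! hneg
  obtain ⟨n, hn⟩ := exists_nat_gt ((C + D) * K)
  have h1 := hlow n
  have h2 := (hbound n).2
  have h3 : ha.lim * n ≤ 0 := mul_nonpos_of_nonpos_of_nonneg hneg n.cast_nonneg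
  have h4 : C + D < n / K := by
    rw [lt_div_iff₀ (by linarith)]
    exact hn
  linarith

/-! ### Rough lines and the four-point inequality -/

section Geometry

variable {X : Type*} [MetricSpace X]

variable (X) in
/-- `δ ≥ 0` is a hyperbolicity constant of `X`. -/
def IsHyperbolicConst (δ : ℝ) : Prop :=
  0 ≤ δ ∧ ∀ w x y z : X,
    min (gromovProduct w x z) (gromovProduct w z y) - δ ≤ gromovProduct w x y

variable (X) in
lemma exists_isHyperbolicConst [GromovHyperbolic X] : ∃ δ, IsHyperbolicConst X δ := by
  obtain ⟨δ, hδ⟩ := GromovHyperbolic.exists_delta (X := X)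
  refine ⟨max δ 0, le_max_right _ _, fun w x y z => ?_⟩
  have := hδ w x y z
  have := le_max_left δ 0
  linarith

/-- Base the Gromov products at `a`: the distances to the base point cancel, leaving a form of
hyperbolicity free of base points. -/
lemma IsHyperbolicConst.four_point {δ : ℝ} (hδ : IsHyperbolicConst X δ) (a b c e : X) :
    dist a b + dist c e ≤ max (dist a c + dist b e) (dist a e + dist b c) + 2 * δ := by
  have h1 := hδ.2 a c e b
  unfold gromovProduct at h1
  rw [dist_comm c a, dist_comm b a, dist_comm e a, dist_comm c b] at h1
  have h2 := le_max_left (dist a c + dist b e) (dist a e + dist b c)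
  have h3 := le_max_right (dist a c + dist b e) (dist a e + dist b c)
  rcases le_total ((dist a c + dist a b - dist b c) / 2)
    ((dist a b + dist a e - dist b e) / 2) with h4 | h4
  · rw [min_eq_left h4] at h1
    linarith
  · rw [min_eq_right h4] at h1
    linarith

lemma IsHyperbolicConst.le_gromovProduct {δ : ℝ} (hδ : IsHyperbolicConst X δ) {w x y z : X}
    {r : ℝ} (h1 : r ≤ gromovProduct w x z) (h2 : r ≤ gromovProduct w z y) :
    r - δ ≤ gromovProduct w x y := by
  have := hδ.2 w x y z
  have := le_min h1 h2
  linarith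

/-- `f` is a rough isometric embedding of the line with metric scaled by `τ`. -/
def IsRoughLine (τ D : ℝ) (f : ℤ → X) : Prop :=
  ∀ m n : ℤ, τ * |(m : ℝ) - n| - D ≤ dist (f m) (f n) ∧
    dist (f m) (f n) ≤ τ * |(m : ℝ) - n| + D

variable {τ D δ : ℝ} {f p q : ℤ → X}

lemma IsRoughLine.error_nonneg (hf : IsRoughLine τ D f) : 0 ≤ D := by
  have := (hf 0 0).2
  simpa using this

lemma IsRoughLine.dist_add (hf : IsRoughLine τ D f) (i : ℤ) (n : ℕ) :
    τ * n - D ≤ dist (f i) (f (i + n)) ∧ dist (f i) (f (i + n)) ≤ τ * n + D := by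
  have := hf i (i + n)
  push_cast at this
  rwa [sub_add_cancel_left, abs_neg, Nat.abs_cast] at this

lemma IsRoughLine.shift (hf : IsRoughLine τ D f) (s : ℤ) : IsRoughLine τ D fun n => f (s + n) := by
  intro m n
  have := hf (s + m) (s + n)
  push_cast at this
  rwa [add_sub_add_left_eq_sub] at this

lemma IsRoughLine.unit_mul (hf : IsRoughLine τ D f) (e : ℤˣ) :
    IsRoughLine τ D fun n => f (e * n) := by
  intro m n
  have := hf (e * m) (e * n)
  push_cast at this
  rwa [← mul_sub, abs_mul, ← Int.cast_abs, Int.isUnit_iff_abs_eq.1 e.isUnit, Int.cast_one,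
    one_mul] at this

/-- Rough lines that are close at two points are close in between. -/
lemma IsRoughLine.dist_le_of_mem (hp : IsRoughLine τ D p) (hq : IsRoughLine τ D q)
    (hδ : IsHyperbolicConst X δ) {R : ℝ} {i : ℤ} {m N : ℕ}
    (h0 : dist (p i) (q i) ≤ R) (hN : dist (p (i + N)) (q (i + N)) ≤ R) (hm : m ≤ N) :
    dist (p (i + m)) (q (i + m)) ≤ R + 3 * D + 2 * δ := by
  obtain ⟨k, rfl⟩ := Nat.exists_eq_add_of_le hm
  have e : i + ((m + k : ℕ) : ℤ) = i + m + k := by push_cast; ring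
  rw [e] at hN
  -- Both cross sums are at most `τ(m + k) + R + 2D`, while the two ends of `p` are at least `τ(m +
  -- k) - D` apart.
  have h1 := hδ.four_point (p (i + m)) (q (i + m)) (p i) (p (i + m + k))
  have h2 := (hp.dist_add i m).2
  have h3 := (hp.dist_add (i + m) k).2
  have h4 := (hq.dist_add i m).2
  have h5 := (hq.dist_add (i + m) k).2
  have h6 := (hp.dist_add i (m + k)).1
  rw [e] at h6
  push_cast at h6
  have h7 := dist_triangle_left (q (i + m)) (p (i + m + k)) (q (i + m + k))
  rw [dist_comm (q (i + m + k)) (q (i + m)), dist_comm (q (i + m + k))] at h7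
  have h8 := dist_triangle (q (i + m)) (q i) (p i)
  rw [dist_comm (q (i + m)) (q i), dist_comm (q i) (p i)] at h8
  rw [dist_comm (p (i + m)) (p i)] at h1
  have h9 : max (dist (p i) (p (i + m)) + dist (q (i + m)) (p (i + m + k)))
      (dist (p (i + m)) (p (i + m + k)) + dist (q (i + m)) (p i))
      ≤ τ * m + τ * k + R + 2 * D := by
    refine max_le ?_ ?_ <;> linarith
  linarith

/-- Gromov products along a rough line. -/
lemma IsRoughLine.le_gromovProduct (hp : IsRoughLine τ D p) (hτ : 0 < τ) {N i j : ℕ}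
    (hi : N ≤ i) (hj : N ≤ j) :
    τ * N - 3 / 2 * D ≤ gromovProduct (p 0) (p i) (p j) := by
  have h1 := (hp i 0).1
  have h2 := (hp j 0).1
  have h3 := (hp i j).2
  simp only [Int.cast_natCast, Int.cast_zero, sub_zero, Nat.abs_cast] at h1 h2 h3
  unfold gromovProduct
  have hi' : τ * N ≤ τ * i := by gcongr
  have hj' : τ * N ≤ τ * j := by gcongr
  rcases le_total (i : ℝ) j with h | h
  · rw [abs_of_nonpos (by linarith)] at h3
    linarith
  · rw [abs_of_nonneg (by linarith)] at h3
    linarith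

/-- If two rough lines are close at `0` and `N` then the Gromov products of their points beyond
`N` are large. -/
lemma IsRoughLine.le_gromovProduct_of_close (hp : IsRoughLine τ D p) (hq : IsRoughLine τ D q)
    (hτ : 0 < τ) (hδ : IsHyperbolicConst X δ) {R : ℝ} {N i j : ℕ}
    (h0 : dist (p 0) (q 0) ≤ R) (hN : dist (p N) (q N) ≤ R) (hi : N ≤ i) (hj : N ≤ j) :
    τ * N - (3 / 2 * D + R + 2 * δ) ≤ gromovProduct (q 0) (p i) (q j) := by
  have hD := hp.error_nonneg
  have hR : 0 ≤ R := dist_nonneg.trans h0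
  -- Chain `p i`, `p N`, `q N`, `q j`: consecutive products are about `τN`, and the two intermediate
  -- points cost `2δ`.
  have h1 := (hp.le_gromovProduct hτ hi le_rfl).trans (gromovProduct_le_base _ (q 0) _ _)
  have h2 := hq.le_gromovProduct hτ (le_refl N) hj
  have h3 : τ * N - (3 / 2 * D + R) ≤ gromovProduct (q 0) (p N) (q N) := by
    unfold gromovProduct
    have h4 := (hq N 0).1
    simp only [Int.cast_natCast, Int.cast_zero, sub_zero, Nat.abs_cast] at h4
    have h5 := dist_triangle_left (q N) (q 0) (p N)
    linarith
  have h4 := hδ.le_gromovProduct (x := p i) (z := p N) (y := q N) (w := q 0)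
    (r := τ * N - (3 / 2 * D + R)) (by linarith) h3
  have h5 := hδ.le_gromovProduct h4 (h2.trans' (by linarith [hδ.1]))
  linarith

/-- Conversely, a large Gromov product forces rough lines to be close on initial segments. -/
lemma IsRoughLine.dist_le_of_gromovProduct (hp : IsRoughLine τ D p) (hq : IsRoughLine τ D q)
    (hτ : 0 < τ) (hδ : IsHyperbolicConst X δ) {n i j : ℕ} (hi : n ≤ i) (hj : n ≤ j)
    (h : τ * n ≤ gromovProduct (q 0) (p i) (q j)) :
    dist (p n) (q n) ≤ 5 * D + 3 * dist (p 0) (q 0) + 4 * δ := by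
  have hD := hp.error_nonneg
  have hd : 0 ≤ dist (p 0) (q 0) := dist_nonneg
  -- Chain `p n`, `p i`, `q j`, `q n`. The product of `p n` and `q n` is then about `τn`, which is
  -- also their distance from the base point, so they are close.
  have h1 := (hp.le_gromovProduct hτ le_rfl hi).trans (gromovProduct_le_base _ (q 0) _ _)
  have h2 := hq.le_gromovProduct hτ hj (le_refl n)
  have h3 := hδ.le_gromovProduct (w := q 0) (x := p n) (z := p i) (y := q j)
    (r := τ * n - 3 / 2 * D - dist (p 0) (q 0)) (by linarith) (by linarith)
  have h4 := hδ.le_gromovProduct h3 (h2.trans' (by linarith [hδ.1]))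
  unfold gromovProduct at h4
  have h5 := (hp 0 n).2
  have h6 := (hq n 0).2
  simp only [Int.cast_natCast, Int.cast_zero, sub_zero, Nat.abs_cast, zero_sub, abs_neg] at h5 h6
  have h7 := dist_triangle_left (p n) (q 0) (p 0)
  linarith

lemma gromovProduct_nonneg (w x y : X) : 0 ≤ gromovProduct w x y := by
  unfold gromovProduct
  have := dist_triangle_right x y w
  linarith

/-- A rough line passes close to `y` if the Gromov product of two of its points based at `y` is
small. -/
lemma IsRoughLine.exists_dist_le (hf : IsRoughLine τ D f) (hτ : 0 < τ)
    (hδ : IsHyperbolicConst X δ) (y : X) (i j : ℤ) :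
    ∃ n, dist y (f n) ≤ gromovProduct y (f i) (f j) + (2 * D + τ + 2 * δ) := by
  wlog hij : i ≤ j generalizing i j
  · obtain ⟨n, hn⟩ := this j i (le_of_not_ge hij)
    exact ⟨n, by rwa [gromovProduct_comm]⟩
  have hD := hf.error_nonneg
  obtain ⟨l, rfl⟩ := Int.le.dest hij
  -- In the comparison tripod of `y`, `f i`, `f (i + l)` the branch point lies at distance `t` from
  -- `f i`; `k` is the corresponding parameter.
  set t := gromovProduct (f i) y (f (i + l)) with ht
  have ht0 : 0 ≤ t := gromovProduct_nonneg _ _ _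
  have htL : t ≤ dist (f i) (f (i + l)) := by
    rw [ht]
    unfold gromovProduct
    have := dist_triangle y (f (i + l)) (f i)
    rw [dist_comm (f (i + l)) (f i)] at this ⊢
    linarith
  set k := ⌊t / τ⌋₊ with hk
  have hk1 : τ * k ≤ t := by
    have := Nat.floor_le (div_nonneg ht0 hτ.le)
    rw [le_div_iff₀ hτ] at this
    linarith
  have hk2 : t < τ * k + τ := by
    have := Nat.lt_floor_add_one (t / τ)
    rw [div_lt_iff₀ hτ, ← hk] at this
    linarith
  have h1 := (hf.dist_add i k).2
  have h2 : dist (f (i + k)) (f (i + l)) ≤ dist (f i) (f (i + l)) - t + (2 * D + τ) := by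
    have h3 := (hf (i + k) (i + l)).2
    have h4 := hf.dist_add i l
    push_cast at h3
    rw [add_sub_add_left_eq_sub] at h3
    -- The line being only rough, `k` may overshoot `l` by a bounded amount.
    rcases le_total (k : ℝ) l with h | h
    · rw [abs_of_nonpos (by linarith)] at h3
      linarith
    · rw [abs_of_nonneg (by linarith)] at h3
      linarith
  refine ⟨i + k, ?_⟩
  have h3 := hδ.four_point y (f (i + k)) (f i) (f (i + l))
  have h4 : max (dist y (f i) + dist (f (i + k)) (f (i + l)))
      (dist y (f (i + l)) + dist (f (i + k)) (f i)) ≤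
      (dist y (f i) + dist y (f (i + l)) + dist (f i) (f (i + l))) / 2 + (2 * D + τ) := by
    rw [dist_comm (f (i + k)) (f i)]
    have e : t = (dist y (f i) + dist (f i) (f (i + l)) - dist y (f (i + l))) / 2 := by
      rw [ht, gromovProduct, dist_comm (f (i + l)) (f i)]
    refine max_le ?_ ?_ <;> linarith
  have e2 : gromovProduct y (f i) (f (i + l)) =
      (dist y (f i) + dist y (f (i + l)) - dist (f i) (f (i + l))) / 2 := by
    rw [gromovProduct, dist_comm (f i) y, dist_comm (f (i + l)) y]
  rw [e2]
  linarith

end Geometry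

/-! ### The Gromov topology on the boundary -/

section BoundaryTopology

variable {X : Type*} [MetricSpace X] [GromovHyperbolic X]

lemma Boundary.exists_rep (ξ : Boundary X) :
    ∃ (u : ℕ → X) (hu : Fellow u u), Boundary.mk u hu = ξ := by
  induction ξ using Quotient.inductionOn with
  | h u => exact ⟨u.1, u.2, rfl⟩

/-- Basic neighbourhoods are defined by some choice of representatives; changing to prescribed ones
costs `δ` at each end. -/
lemma Boundary.eventually_of_mem_nhd {δ : ℝ} (hδ : IsHyperbolicConst X δ) {w : X} {r : ℝ}
    {u v : ℕ → X} {hu : Fellow u u} {hv : Fellow v v}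
    (h : Boundary.mk v hv ∈ Boundary.nhd w (Boundary.mk u hu) r) :
    ∀ᶠ p : ℕ × ℕ in atTop, r - 2 * δ ≤ gromovProduct w (u p.1) (v p.2) := by
  obtain ⟨u', v', hu', hv', h1, h2, h3⟩ := h
  obtain ⟨a, ha⟩ := eventually_atTop.1
    (tendsto_atTop.1 ((Boundary.mk_eq_mk.1 h1).symm w) r)
  obtain ⟨b, hb⟩ := eventually_atTop.1 (tendsto_atTop.1 (Boundary.mk_eq_mk.1 h2 w) r)
  obtain ⟨c, hc⟩ := eventually_atTop.1 h3
  refine eventually_atTop.2 ⟨(a.1, b.2), fun p hp => ?_⟩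
  have e1 := ha (p.1, max a.2 c.1) ⟨hp.1, le_max_left _ _⟩
  have e2 := hc (max a.2 c.1, max c.2 b.1) ⟨le_max_right _ _, le_max_left _ _⟩
  have e3 := hb (max c.2 b.1, p.2) ⟨le_max_right _ _, hp.2⟩
  have e4 := hδ.le_gromovProduct (hδ.le_gromovProduct e1 e2) (e3.trans' (by linarith [hδ.1]))
  linarith

lemma Boundary.mem_nhd_self (w : X) (ξ : Boundary X) (r : ℝ) : ξ ∈ Boundary.nhd w ξ r := by
  obtain ⟨u, hu, rfl⟩ := ξ.exists_rep
  exact ⟨u, u, hu, hu, rfl, rfl, tendsto_atTop.1 (hu w) r⟩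

lemma Boundary.nhd_subset_nhd (w w' : X) (ξ : Boundary X) (r : ℝ) :
    Boundary.nhd w ξ (r + dist w w') ⊆ Boundary.nhd w' ξ r := by
  rintro η ⟨u, v, hu, hv, h1, h2, h3⟩
  refine ⟨u, v, hu, hv, h1, h2, h3.mono fun p hp => ?_⟩
  have := gromovProduct_le_base w w' (u p.1) (v p.2)
  linarith

/-- Of the `3δ`, fixing representatives uses two and the hyperbolic inequality one. This is what
makes the sets `nhd` neighbourhoods although they need not be open. -/
lemma Boundary.nhd_trans {δ : ℝ} (hδ : IsHyperbolicConst X δ) {w : X} {r : ℝ}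
    {ξ η ζ : Boundary X} (h : η ∈ Boundary.nhd w ξ (r + 3 * δ))
    (h' : ζ ∈ Boundary.nhd w η (r + 3 * δ)) : ζ ∈ Boundary.nhd w ξ r := by
  obtain ⟨u, hu, rfl⟩ := ξ.exists_rep
  obtain ⟨v, hv, rfl⟩ := η.exists_rep
  obtain ⟨t, ht, rfl⟩ := ζ.exists_rep
  obtain ⟨a, ha⟩ := eventually_atTop.1 (Boundary.eventually_of_mem_nhd hδ h)
  obtain ⟨b, hb⟩ := eventually_atTop.1 (Boundary.eventually_of_mem_nhd hδ h')
  refine ⟨u, t, hu, ht, rfl, rfl, eventually_atTop.2 ⟨(a.1, b.2), fun p hp => ?_⟩⟩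
  have e1 := ha (p.1, max a.2 b.1) ⟨hp.1, le_max_left _ _⟩
  have e2 := hb (max a.2 b.1, p.2) ⟨le_max_right _ _, hp.2⟩
  have e3 := hδ.le_gromovProduct e1 e2
  linarith

lemma Boundary.nhd_mem_nhds (w : X) (ξ : Boundary X) (r : ℝ) : Boundary.nhd w ξ r ∈ 𝓝 ξ := by
  obtain ⟨δ, hδ⟩ := exists_isHyperbolicConst X
  -- The candidate for the interior; it is open by `nhd_trans`.
  refine mem_nhds_iff.2 ⟨{η | ∃ r', Boundary.nhd w η r' ⊆ Boundary.nhd w ξ r},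
    fun η ⟨r', hr'⟩ => hr' (mem_nhd_self w η r'), ?_, ⟨r, subset_rfl⟩⟩
  rintro η ⟨r', hr'⟩ w'
  exact ⟨r' + 3 * δ + dist w' w, fun ζ hζ => ⟨r' + 3 * δ, fun θ hθ =>
    hr' (nhd_trans hδ (nhd_subset_nhd w' w η _ hζ) hθ)⟩⟩

lemma Boundary.nhds_hasBasis (w : X) (ξ : Boundary X) :
    (𝓝 ξ).HasBasis (fun _ : ℝ => True) (Boundary.nhd w ξ) := by
  refine ⟨fun t => ⟨fun ht => ?_, fun ⟨r, _, hr⟩ => mem_of_superset (nhd_mem_nhds w ξ r) hr⟩⟩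
  obtain ⟨U, hU, hUo, hξ⟩ := mem_nhds_iff.1 ht
  obtain ⟨r, hr⟩ := hUo ξ hξ w
  exact ⟨r, trivial, hr.trans hU⟩

lemma Boundary.eq_of_forall_mem_nhd {w : X} {ξ η : Boundary X}
    (h : ∀ r, η ∈ Boundary.nhd w ξ r) : ξ = η := by
  obtain ⟨δ, hδ⟩ := exists_isHyperbolicConst X
  obtain ⟨u, hu, rfl⟩ := ξ.exists_rep
  obtain ⟨v, hv, rfl⟩ := η.exists_rep
  refine Boundary.mk_eq_mk.2 fun w' => tendsto_atTop.2 fun b => ?_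
  have := eventually_of_mem_nhd hδ
    (nhd_subset_nhd w w' _ (b + 2 * δ) (h (b + 2 * δ + dist w w')))
  simpa using this

/-- Separation is used below to delete finitely many points from a neighbourhood. -/
instance : T1Space (Boundary X) := by
  refine ((t1Space_TFAE (Boundary X)).out 0 4).2 ?_
  intro ξ η hne
  obtain ⟨u, -, -⟩ := ξ.exists_rep
  by_contra hcon
  refine hne (Boundary.eq_of_forall_mem_nhd (w := u 0) fun r => ?_)
  by_contra hr
  exact hcon (mem_of_superset (Boundary.nhd_mem_nhds (u 0) ξ r)
    (Set.subset_compl_singleton_iff.2 hr))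

instance {Γ : Type*} [Group Γ] [MulAction Γ X] [IsIsometricSMul Γ X] :
    ContinuousConstSMul Γ (Boundary X) := by
  refine ⟨fun g => continuous_iff_continuousAt.2 fun ξ => ?_⟩
  obtain ⟨w, -, -⟩ := ξ.exists_rep
  refine ((Boundary.nhds_hasBasis (g⁻¹ • w 0) ξ).tendsto_iff
    (Boundary.nhds_hasBasis (w 0) (g • ξ))).2 fun r _ => ⟨r, trivial, ?_⟩
  rintro _ ⟨u, v, hu, hv, rfl, rfl, h⟩
  refine ⟨_, _, hu.smul g, hv.smul g, rfl, rfl, h.mono fun p hp => ?_⟩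
  rwa [gromovProduct_smul]

end BoundaryTopology

/-! ### Isolated pairs, ordered and unordered -/

section Isolated

variable {Γ B : Type*} [Group Γ] [TopologicalSpace B] [MulAction Γ B]

variable (Γ) in
/-- The ordered pair `(a, b)` is isolated in its orbit. -/
def OrderedIsolated (a b : B) : Prop :=
  ∃ U ∈ 𝓝 a, ∃ V ∈ 𝓝 b, ∀ g : Γ, g • a ∈ U → g • b ∈ V → g • a = a ∧ g • b = b

variable (Γ) in
/-- The unordered pair `{a, b}` is isolated in its orbit. -/
def UnorderedIsolated (a b : B) : Prop :=
  ∃ U ∈ 𝓝 a, ∃ V ∈ 𝓝 b, ∀ g : Γ, (g • a ∈ U ∧ g • b ∈ V) ∨ (g • a ∈ V ∧ g • b ∈ U) →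
    g • ({a, b} : Set B) = {a, b}

lemma smul_pair {Γ B : Type*} [Group Γ] [MulAction Γ B] (g : Γ) (a b : B) : g • ({a, b} : Set B) = {g • a, g • b} :=
  Set.image_pair _ _ _

/-- The issue is elements that nearly swap `a` and `b`. If `k` is one and `g` is another, close
enough to a swap, then `k * g` nearly fixes the pair, hence fixes it, and `g • (a, b) = k⁻¹ • (a,
b)`. So only one point of the orbit lies near `(b, a)`: either it is `(b, a)`, which is harmless, or
it is removed by shrinking a neighbourhood. -/
lemma OrderedIsolated.unordered [ContinuousConstSMul Γ B] [T1Space B] {a b : B}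
    (h : OrderedIsolated Γ a b) : UnorderedIsolated Γ a b := by
  obtain ⟨U, hU, V, hV, hUV⟩ := h
  have key : ∀ g : Γ, g • a ∈ U ∧ g • b ∈ V → g • ({a, b} : Set B) = {a, b} := fun g hg => by
    obtain ⟨h1, h2⟩ := hUV g hg.1 hg.2
    rw [smul_pair, h1, h2]
  by_cases hex : ∃ k : Γ, k • a ∈ interior V ∧ k • b ∈ interior U
  · obtain ⟨k, hka, hkb⟩ := hex
    have hU2 : U ∩ (k • ·) ⁻¹' V ∈ 𝓝 a :=
      inter_mem hU ((continuous_const_smul k).continuousAt (mem_interior_iff_mem_nhds.1 hka))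
    have hV2 : V ∩ (k • ·) ⁻¹' U ∈ 𝓝 b :=
      inter_mem hV ((continuous_const_smul k).continuousAt (mem_interior_iff_mem_nhds.1 hkb))
    have hk : ∀ g : Γ, g • a ∈ V ∩ (k • ·) ⁻¹' U → g • b ∈ U ∩ (k • ·) ⁻¹' V →
        g • a = k⁻¹ • a ∧ g • b = k⁻¹ • b := fun g hga hgb => by
      rw [eq_inv_smul_iff, eq_inv_smul_iff, smul_smul, smul_smul]
      refine hUV (k * g) ?_ ?_
      · rw [mul_smul]; exact hga.2
      · rw [mul_smul]; exact hgb.2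
    by_cases hb : k⁻¹ • a = b
    · by_cases ha : k⁻¹ • b = a
      · refine ⟨_, hU2, _, hV2, ?_⟩
        rintro g (hg | hg)
        · exact key g ⟨hg.1.1, hg.2.1⟩
        · obtain ⟨h1, h2⟩ := hk g hg.1 hg.2
          rw [smul_pair, h1, h2, ha, hb, Set.pair_comm]
      · refine ⟨_, inter_mem hU2 (compl_singleton_mem_nhds (Ne.symm ha)), _, hV2, ?_⟩
        rintro g (hg | hg)
        · exact key g ⟨hg.1.1.1, hg.2.1⟩
        · exact absurd (hk g hg.1 hg.2.1).2 hg.2.2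
    · refine ⟨_, hU2, _, inter_mem hV2 (compl_singleton_mem_nhds (Ne.symm hb)), ?_⟩
      rintro g (hg | hg)
      · exact key g ⟨hg.1.1, hg.2.1.1⟩
      · exact absurd (hk g hg.1.1 hg.2).1 hg.1.2
  · refine ⟨interior U, interior_mem_nhds.2 hU, interior V, interior_mem_nhds.2 hV, ?_⟩
    rintro g (hg | hg)
    · exact key g ⟨interior_subset hg.1, interior_subset hg.2⟩
    · exact absurd ⟨g, hg⟩ hex

end Isolated

/-! ### Isolation and discreteness of orbits -/

section Discreteness

variable {X : Type*} [MetricSpace X] [GromovHyperbolic X]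
  {Γ : Type*} [Group Γ] [MulAction Γ X] [IsIsometricSMul Γ X]

/-- Isolation speaks of a single point of the orbit; translating by `g⁻¹` transports it to the
others. -/
lemma orderedIsolated_iff_isDiscrete {a b : Boundary X} (hab : a ≠ b) :
    OrderedIsolated Γ a b ↔
      IsDiscrete {p : OrderedPairs X | p.1 ∈ MulAction.orbit Γ (a, b)} := by
  constructor
  · rintro ⟨U, hU, V, hV, hUV⟩
    refine IsDiscrete.of_nhdsWithin ?_
    rintro ⟨p, hp⟩ ⟨g, hg⟩
    rw [le_pure_iff]
    have hg' : (g • a, g • b) = p := hg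
    subst hg'
    have h1 : (g⁻¹ • ·) ⁻¹' U ∈ 𝓝 (g • a) :=
      (continuous_const_smul g⁻¹).continuousAt (by rwa [inv_smul_smul])
    have h2 : (g⁻¹ • ·) ⁻¹' V ∈ 𝓝 (g • b) :=
      (continuous_const_smul g⁻¹).continuousAt (by rwa [inv_smul_smul])
    have h3 := continuous_subtype_val.continuousAt (x := (⟨_, hp⟩ : OrderedPairs X))
      (prod_mem_nhds h1 h2)
    rw [mem_nhdsWithin_iff_exists_mem_nhds_inter]
    refine ⟨_, h3, ?_⟩
    rintro ⟨q, hq⟩ ⟨hq1, k, hk⟩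
    have hk' : (k • a, k • b) = q := hk
    subst hk'
    obtain ⟨e1, e2⟩ := hUV (g⁻¹ * k) (by rw [mul_smul]; exact hq1.1)
      (by rw [mul_smul]; exact hq1.2)
    rw [mul_smul, inv_smul_eq_iff] at e1 e2
    simp [e1, e2]
  · intro h
    obtain ⟨O, hO, hOs⟩ := isOpen_inter_eq_singleton_of_mem_discrete h
      (x := ⟨(a, b), hab⟩) (MulAction.mem_orbit_self _)
    obtain ⟨O', hO', rfl⟩ := isOpen_induced_iff.1 hO
    have hmem : (⟨(a, b), hab⟩ : OrderedPairs X) ∈ Subtype.val ⁻¹' O' :=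
      (hOs.symm.subset rfl).1
    obtain ⟨U, hU, V, hV, hUV⟩ := mem_nhds_prod_iff.1 (hO'.mem_nhds hmem)
    refine ⟨U, hU, V, hV, fun g h1 h2 => ?_⟩
    have hne : g • a ≠ g • b := fun h => hab (smul_left_cancel g h)
    have : (⟨(g • a, g • b), hne⟩ : OrderedPairs X) ∈ ({⟨(a, b), hab⟩} : Set (OrderedPairs X)) :=
      hOs.subset ⟨hUV ⟨h1, h2⟩, g, rfl⟩
    simpa using this

lemma unorderedIsolated_iff_isDiscrete {a b : Boundary X} (hab : a ≠ b) :
    UnorderedIsolated Γ a b ↔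
      IsDiscrete {s : TwoPointSubsets X | s.1 ∈ MulAction.orbit Γ ({a, b} : Set (Boundary X))} := by
  constructor
  · rintro ⟨U, hU, V, hV, hUV⟩
    refine IsDiscrete.of_nhdsWithin ?_
    rintro s ⟨g, hg⟩
    have hg' : g • ({a, b} : Set (Boundary X)) = s.1 := hg
    refine le_pure_iff.2 (mem_nhdsWithin.2 ?_)
    set U' := (g⁻¹ • · : Boundary X → Boundary X) ⁻¹' interior U
    set V' := (g⁻¹ • · : Boundary X → Boundary X) ⁻¹' interior V
    have hU' : IsOpen U' := isOpen_interior.preimage (continuous_const_smul g⁻¹)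
    have hV' : IsOpen V' := isOpen_interior.preimage (continuous_const_smul g⁻¹)
    refine ⟨{t | ∃ ξ η, t.1 = {ξ, η} ∧ ξ ∈ U' ∧ η ∈ V'}, ?_,
      ⟨g • a, g • b, hg'.symm.trans (smul_pair g a b), ?_, ?_⟩, ?_⟩
    -- Openness in the quotient: the preimage is the symmetrized product of `U'` and `V'`.
    · refine isOpen_coinduced.2 ?_
      have : OrderedPairs.forget ⁻¹'
          {t : TwoPointSubsets X | ∃ ξ η, t.1 = {ξ, η} ∧ ξ ∈ U' ∧ η ∈ V'} =
          Subtype.val ⁻¹' (U' ×ˢ V' ∪ V' ×ˢ U') := by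
        ext ⟨⟨p, q⟩, hpq⟩
        constructor
        · rintro ⟨ξ, η, h, h1, h2⟩
          have h' : ({p, q} : Set (Boundary X)) = {ξ, η} := h
          rcases Set.pair_eq_pair_iff.1 h' with ⟨rfl, rfl⟩ | ⟨rfl, rfl⟩
          · exact Or.inl ⟨h1, h2⟩
          · exact Or.inr ⟨h2, h1⟩
        · rintro (h | h)
          · exact ⟨p, q, rfl, h.1, h.2⟩
          · exact ⟨q, p, Set.pair_comm p q, h.2, h.1⟩
      rw [this]
      exact ((hU'.prod hV').union (hV'.prod hU')).preimage continuous_subtype_val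
    · change g⁻¹ • g • a ∈ interior U
      rw [inv_smul_smul]
      exact mem_of_mem_nhds (interior_mem_nhds.2 hU)
    · change g⁻¹ • g • b ∈ interior V
      rw [inv_smul_smul]
      exact mem_of_mem_nhds (interior_mem_nhds.2 hV)
    · rintro t ⟨⟨ξ, η, h, h1, h2⟩, k, hk⟩
      have hk' : k • ({a, b} : Set (Boundary X)) = t.1 := hk
      rw [← hk', smul_pair] at h
      have hfix : (g⁻¹ * k) • ({a, b} : Set (Boundary X)) = {a, b} := by
        refine hUV _ ?_
        rw [mul_smul, mul_smul]
        rcases Set.pair_eq_pair_iff.1 h with ⟨e1, e2⟩ | ⟨e1, e2⟩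
        · rw [e1, e2]
          exact Or.inl ⟨interior_subset h1, interior_subset h2⟩
        · rw [e1, e2]
          exact Or.inr ⟨interior_subset h2, interior_subset h1⟩
      rw [mul_smul, inv_smul_eq_iff, hk', hg'] at hfix
      exact Subtype.ext hfix
  · intro h
    obtain ⟨O, hO, hOs⟩ := isOpen_inter_eq_singleton_of_mem_discrete h
      (x := OrderedPairs.forget ⟨(a, b), hab⟩) (MulAction.mem_orbit_self _)
    obtain ⟨O', hO', hOO'⟩ := isOpen_induced_iff.1 (isOpen_coinduced.1 hO)
    have hmem : (⟨(a, b), hab⟩ : OrderedPairs X) ∈ Subtype.val ⁻¹' O' := by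
      rw [hOO']
      exact (hOs.symm.subset rfl).1
    obtain ⟨U, hU, V, hV, hUV⟩ := mem_nhds_prod_iff.1 (hO'.mem_nhds hmem)
    refine ⟨U, hU, V, hV, fun g hg => ?_⟩
    have key : ∀ ξ η : Boundary X, ξ ∈ U → η ∈ V → ξ ≠ η →
        g • ({a, b} : Set (Boundary X)) = {ξ, η} → g • ({a, b} : Set (Boundary X)) = {a, b} := by
      intro ξ η hξ hη hne he
      have h1 : (⟨(ξ, η), hne⟩ : OrderedPairs X) ∈ OrderedPairs.forget ⁻¹' O := by
        rw [← hOO']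
        exact hUV ⟨hξ, hη⟩
      have h2 := hOs.subset ⟨h1, g, he⟩
      rw [he]
      exact congrArg Subtype.val h2
    have hne : g • a ≠ g • b := fun h => hab (smul_left_cancel g h)
    rcases hg with hg | hg
    · exact key _ _ hg.1 hg.2 hne (smul_pair g a b)
    · exact key _ _ hg.2 hg.1 hne.symm (by rw [smul_pair, Set.pair_comm])

end Discreteness

/-! ### Asymptotic and overlapping rough lines -/

section RoughLines

variable {X : Type*} [MetricSpace X] {τ D δ : ℝ} {f p q : ℤ → X}

lemma IsRoughLine.fellow (hf : IsRoughLine τ D f) (hτ : 0 < τ) :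
    Fellow (fun n : ℕ => f n) (fun n : ℕ => f n) := by
  intro w
  refine tendsto_atTop.2 fun b => ?_
  obtain ⟨n, hn⟩ := exists_nat_ge ((b + dist (f 0) w + 3 / 2 * D) / τ)
  rw [div_le_iff₀ hτ] at hn
  refine eventually_atTop.2 ⟨(n, n), fun r hr => ?_⟩
  have h1 := hf.le_gromovProduct hτ hr.1 hr.2
  have h2 := gromovProduct_le_base (f 0) w (f r.1) (f r.2)
  linarith

/-- Based at `f 0`, the product of `f n` and `f (-n)` never exceeds `3D/2`. -/
lemma IsRoughLine.not_fellow_neg (hf : IsRoughLine τ D f) :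
    ¬ Fellow (fun n : ℕ => f n) (fun n : ℕ => f (-n)) := by
  intro h
  obtain ⟨a, ha⟩ := eventually_atTop.1 (tendsto_atTop.1 (h (f 0)) (3 / 2 * D + 1))
  have h1 := ha (max a.1 a.2, max a.1 a.2) ⟨le_max_left _ _, le_max_right _ _⟩
  set n := max a.1 a.2
  have h2 := (hf n 0).2
  have h3 := (hf (-n) 0).2
  have h4 := (hf n (-n)).1
  unfold gromovProduct at h1
  push_cast at h2 h3 h4
  rw [sub_zero, Nat.abs_cast] at h2
  rw [sub_zero, abs_neg, Nat.abs_cast] at h3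
  rw [sub_neg_eq_add, abs_of_nonneg (by positivity)] at h4
  dsimp only at h1
  linarith

lemma IsRoughLine.gromovProduct_neg_le (hf : IsRoughLine τ D f) (n : ℕ) :
    gromovProduct (f 0) (f n) (f (-n)) ≤ 3 / 2 * D := by
  have h2 := (hf n 0).2
  have h3 := (hf (-n) 0).2
  have h4 := (hf n (-n)).1
  unfold gromovProduct
  push_cast at h2 h3 h4
  rw [sub_zero, Nat.abs_cast] at h2
  rw [sub_zero, abs_neg, Nat.abs_cast] at h3
  rw [sub_neg_eq_add, abs_of_nonneg (by positivity)] at h4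
  linarith

/-- Rough lines converging to the same boundary point are asymptotic. -/
lemma IsRoughLine.exists_dist_le_of_fellow (hp : IsRoughLine τ D p) (hq : IsRoughLine τ D q)
    (hτ : 0 < τ) (hδ : IsHyperbolicConst X δ)
    (h : Fellow (fun n : ℕ => p n) (fun n : ℕ => q n)) :
    ∃ R, ∀ n : ℕ, dist (p n) (q n) ≤ R := by
  refine ⟨5 * D + 3 * dist (p 0) (q 0) + 4 * δ, fun n => ?_⟩
  obtain ⟨a, ha⟩ := eventually_atTop.1 (tendsto_atTop.1 (h (q 0)) (τ * n))
  exact hp.dist_le_of_gromovProduct hq hτ hδ (le_max_right a.1 n) (le_max_right a.2 n)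
    (ha (max a.1 n, max a.2 n) ⟨le_max_left _ _, le_max_left _ _⟩)

/-- Rough lines whose ends are close on the boundary pass close to each other. -/
lemma IsRoughLine.exists_shift_dist_le (hp : IsRoughLine τ D p) (hq : IsRoughLine τ D q)
    (hτ : 0 < τ) (hδ : IsHyperbolicConst X δ) {r : ℝ} {N : ℕ}
    (hr1 : 3 / 2 * D + 2 * δ < r) (hr2 : τ * N ≤ r)
    (hpos : ∀ᶠ a : ℕ × ℕ in atTop, r ≤ gromovProduct (q 0) (p a.1) (q a.2))
    (hneg : ∀ᶠ a : ℕ × ℕ in atTop, r ≤ gromovProduct (q 0) (p (-a.1)) (q (-a.2))) :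
    ∃ s : ℤ, ∀ n : ℕ, n ≤ N →
      dist (p (s + n)) (q n) ≤ 5 * D + 3 * (7 / 2 * D + τ + 4 * δ) + 4 * δ := by
  obtain ⟨a, ha⟩ := eventually_atTop.1 hpos
  obtain ⟨b, hb⟩ := eventually_atTop.1 hneg
  set i := max (max a.1 a.2) (max b.1 b.2)
  have hi : a ≤ (i, i) := ⟨(le_max_left _ _).trans (le_max_left _ _),
    (le_max_right _ _).trans (le_max_left _ _)⟩
  have hi' : b ≤ (i, i) := ⟨(le_max_left _ _).trans (le_max_right _ _),
    (le_max_right _ _).trans (le_max_right _ _)⟩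
  have h1 := ha _ hi
  have h2 := hb _ hi'
  dsimp only at h1 h2
  -- Otherwise the chain `q i`, `p i`, `p (-i)`, `q (-i)` would make the product of the opposite
  -- points of `q` exceed `3D/2`. Hence `p` passes near `q 0`, at a parameter `s`.
  have h3 : gromovProduct (q 0) (p i) (p (-i)) ≤ 3 / 2 * D + 2 * δ := by
    by_contra! hcon
    set t := min r (gromovProduct (q 0) (p i) (p (-i))) with ht
    have ht1 : 3 / 2 * D + 2 * δ < t := lt_min hr1 hcon
    have e1 : t ≤ gromovProduct (q 0) (q i) (p i) := by
      rw [gromovProduct_comm]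
      exact (min_le_left _ _).trans h1
    have e2 := hδ.le_gromovProduct e1 (min_le_right r _)
    have ht2 : t ≤ r := min_le_left _ _
    have e3 := hδ.le_gromovProduct e2 (h2.trans' (by linarith [hδ.1]))
    have := hq.gromovProduct_neg_le i
    linarith
  obtain ⟨s, hs⟩ := hp.exists_dist_le hτ hδ (q 0) i (-i)
  refine ⟨s, fun n hn => ?_⟩
  have hs' : dist (p (s + 0)) (q 0) ≤ 7 / 2 * D + τ + 4 * δ := by
    rw [dist_comm, add_zero]
    linarith
  -- One point of `p` beyond both `i` and `s + N`, with its parameter counted from `s` as `m` and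
  -- from `0` as `m'`; `s` may be negative.
  obtain ⟨m, hm⟩ : ∃ m : ℕ, s + m = max (i : ℤ) (s + N) :=
    ⟨(max (i : ℤ) (s + N) - s).toNat, by omega⟩
  obtain ⟨m', hm'⟩ : ∃ m' : ℕ, (m' : ℤ) = max (i : ℤ) (s + N) ∧ i ≤ m' :=
    ⟨(max (i : ℤ) (s + N)).toNat, by omega, by omega⟩
  have h4 := ha (m', max i N) ⟨hi.1.trans hm'.2, hi.2.trans (le_max_left _ _)⟩
  have h5 := (hp.shift s).dist_le_of_gromovProduct hq hτ hδ (n := n) (i := m) (j := max i N)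
    (by omega) (by omega) (by
      dsimp only at h4
      rw [hm'.1, ← hm] at h4
      have : τ * n ≤ τ * N := by gcongr
      linarith)
  linarith

/-- Closest points on a set at bounded distance from a rough line. -/
lemma IsRoughLine.dist_add_dist_le (hf : IsRoughLine τ D f) (hτ : 0 < τ)
    (hδ : IsHyperbolicConst X δ) {C : ℝ} {y u v : X} {i j : ℤ}
    (hu : dist u (f i) ≤ C) (hv : dist v (f j) ≤ C) (hmin : ∀ n, dist y u ≤ dist y (f n)) :
    dist y u + dist u v ≤ dist y v + 2 * (2 * C + (2 * D + τ + 2 * δ)) := by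
  -- Some `f n` is within about `(f i | f j)` of `y`, the product based at `y`. As `u` is at least
  -- as close, passing from `y` to `v` through `u` is nearly shortest.
  obtain ⟨n, hn⟩ := hf.exists_dist_le hτ hδ y i j
  have h1 := hmin n
  unfold gromovProduct at hn
  have h2 := dist_triangle_left (f i) y u
  have h3 := dist_triangle_left (f j) y v
  have h4 := dist_triangle4 u (f i) (f j) v
  rw [dist_comm (f j) v] at h4
  rw [dist_comm u y] at h2
  rw [dist_comm v y] at h3
  linarith

/-- If the closest points of `y` and `y'` are far apart, they are close to any rough line passing
close to `y` and `y'`. -/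
lemma IsRoughLine.exists_close_of_far_projections (hf : IsRoughLine τ D f)
    (hp : IsRoughLine τ D p) (hτ : 0 < τ) (hδ : IsHyperbolicConst X δ) {C : ℝ} {y y' u u' : X}
    {i i' j j' : ℤ}
    (hu : dist u (f i) ≤ C) (hu' : dist u' (f i') ≤ C)
    (hy : dist y (p j) ≤ C) (hy' : dist y' (p j') ≤ C)
    (hmin : ∀ n, dist y u ≤ dist y (f n)) (hmin' : ∀ n, dist y' u' ≤ dist y' (f n))
    (hfar : 2 * (2 * C + (2 * D + τ + 2 * δ)) + δ < dist u u') :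
    ∃ s, dist (f i) (p s) ≤ 7 * C + 3 * (2 * D + τ + 2 * δ) + δ := by
  have h1 := hf.dist_add_dist_le hτ hδ hu hu' hmin
  have h2 := hf.dist_add_dist_le hτ hδ hu' hu hmin'
  have h3 := hδ.four_point y u' y' u
  rw [dist_comm u' u] at h2 h3
  rw [dist_comm u' y'] at h3
  -- If the other sum were the larger one, `h1` and `h2` would bound `dist u u'` against `hfar`. It
  -- follows that `y` and `y'` have bounded product based at `u`, so `p` passes near `u`.
  have h4 : dist y u' + dist y' u ≤ dist y y' + dist u u' + 2 * δ := by
    rcases le_total (dist y u + dist y' u') (dist y y' + dist u u') with h | h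
    · rw [add_comm (dist y y')] at h
      rw [max_eq_left (by linarith)] at h3
      linarith
    · rw [max_eq_right (by linarith)] at h3
      linarith
  obtain ⟨s, hs⟩ := hp.exists_dist_le hτ hδ u j j'
  refine ⟨s, ?_⟩
  unfold gromovProduct at hs
  have h5 := dist_triangle_left (p j) u y
  have h6 := dist_triangle_left (p j') u y'
  have h7 := dist_triangle4 y (p j) (p j') y'
  rw [dist_comm (p j') y'] at h7
  have h8 := dist_triangle_left (f i) (p s) u
  have h9 := dist_triangle y' u' u
  rw [dist_comm u' u] at h9
  linarith

/-- Two rough lines that are close at two far apart places are close along a long segment, up to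
orientation and shift. -/
lemma IsRoughLine.exists_overlap (hf : IsRoughLine τ D f) (hp : IsRoughLine τ D p) (hτ : 0 < τ)
    (hδ : IsHyperbolicConst X δ) {C : ℝ} {N : ℕ} {a a' s s' : ℤ} (haa : a ≤ a')
    (h : dist (f a) (p s) ≤ C) (h' : dist (f a') (p s') ≤ C)
    (hfar : τ * (2 * N) + 3 * D + 2 * C ≤ dist (f a) (f a')) :
    ∃ (e : ℤˣ) (a₀ s₀ : ℤ), ∀ n : ℤ, |n| ≤ N →
      dist (p (s₀ + e * n)) (f (a₀ + n)) ≤ 3 * C + 6 * D + 2 * δ := by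
  obtain ⟨A, rfl⟩ := Int.le.dest haa
  obtain ⟨e, B, rfl⟩ : ∃ (e : ℤˣ) (B : ℕ), s' = s + e * B := by
    rcases Int.natAbs_eq (s' - s) with hs | hs
    · exact ⟨1, (s' - s).natAbs, by rw [Units.val_one]; omega⟩
    · exact ⟨-1, (s' - s).natAbs, by rw [Units.val_neg, Units.val_one]; omega⟩
  have hD := hf.error_nonneg
  have hC : 0 ≤ C := dist_nonneg.trans h
  have hP : IsRoughLine τ D fun n => p (s + e * n) := (hp.shift s).unit_mul e
  have hF := hf.shift a
  have h1 := hF.dist_add 0 A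
  have h2 := hP.dist_add 0 B
  have h3 := hF A B
  simp only [zero_add, mul_zero, add_zero] at h1 h2
  push_cast at h3
  have h4 := dist_triangle4 (f a) (p s) (p (s + e * B)) (f (a + A))
  have h5 := dist_triangle4 (p s) (f a) (f (a + A)) (p (s + e * B))
  rw [dist_comm (p (s + e * B)) (f (a + A))] at h4
  rw [dist_comm (p s) (f a)] at h5
  -- The ends of the two segments are equally far apart up to `2C`, so the parameter lengths nearly
  -- agree and both lines can be compared at `B`.
  have hAB : τ * |(A : ℝ) - B| ≤ 2 * C + 2 * D := by
    rcases le_total (B : ℝ) A with hle | hle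
    · rw [abs_of_nonneg (by linarith)]
      linarith
    · rw [abs_of_nonpos (by linarith)]
      linarith
  have h6 : dist (p (s + e * B)) (f (a + B)) ≤ 3 * C + 3 * D := by
    have := dist_triangle_left (p (s + e * B)) (f (a + B)) (f (a + A))
    linarith
  have hB : 2 * N ≤ B := by
    have : τ * (2 * N) ≤ τ * B := by linarith
    have := le_of_mul_le_mul_left this hτ
    exact_mod_cast this
  -- Since `2N ≤ B`, the window of radius `N` about parameter `N` lies in `[0, B]`.
  refine ⟨e, a + N, s + e * N, fun n hn => ?_⟩
  obtain ⟨m, hm⟩ : ∃ m : ℕ, (m : ℤ) = N + n := ⟨(N + n).toNat, by rw [abs_le] at hn; omega⟩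
  have hmB : m ≤ B := by
    rw [abs_le] at hn
    omega
  have h7 := hP.dist_le_of_mem hF hδ (R := 3 * C + 3 * D) (i := 0) (m := m) (N := B)
    (by simp only [mul_zero, add_zero]; rw [dist_comm]; linarith)
    (by simpa only [zero_add] using h6) hmB
  simp only [zero_add, hm] at h7
  rw [mul_add, ← add_assoc, ← add_assoc] at h7
  linarith

end RoughLines

/-! ### Orbits of loxodromic elements and their endpoints -/

section Loxodromic

variable {X : Type*} [MetricSpace X] {Γ : Type*} [Group Γ] [MulAction Γ X] [IsIsometricSMul Γ X]

lemma IsRoughLine.smul {τ D : ℝ} {f : ℤ → X} (hf : IsRoughLine τ D f) (g : Γ) :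
    IsRoughLine τ D fun n => g • f n := by
  intro m n
  simpa only [dist_smul] using hf m n

variable [GromovHyperbolic X]

/-- The orbits of a loxodromic isometry are rough lines. -/
lemma IsLoxodromic.exists_isRoughLine {h : Γ} (hh : IsLoxodromic X h) (x : X) :
    ∃ τ > 0, ∃ D, IsRoughLine τ D fun n : ℤ => h ^ n • x := by
  obtain ⟨δ, hδ⟩ := exists_isHyperbolicConst X
  obtain ⟨K, C, hK, -, hQ⟩ := hh x
  set a : ℕ → ℝ := fun n => dist x (h ^ n • x) with ha
  have hd : ∀ i k : ℕ, dist (h ^ i • x) (h ^ (i + k) • x) = a k := fun i k => by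
    rw [pow_add, mul_smul, dist_smul]
  have hlow : ∀ n : ℕ, (n : ℝ) / K - C ≤ a n := fun n => by
    have := (hQ 0 n).1
    dsimp only at this
    rw [zpow_zero, one_smul, zpow_natCast, Int.dist_eq] at this
    simpa using this
  have hsub : ∀ m n, a (m + n) ≤ a m + a n := fun m n => by
    have := dist_triangle x (h ^ m • x) (h ^ (m + n) • x)
    rwa [hd] at this
  have hrev : ∀ m n, a m ≤ a (m + n) + a n := fun m n => by
    have := dist_triangle_right x (h ^ m • x) (h ^ (m + n) • x)
    rwa [hd] at this
  -- The four-point inequality for four successive points of the orbit.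
  have hfp : ∀ p q r,
      a (p + q) + a (q + r) ≤ max (a p + a r) (a q + a (p + q + r)) + 2 * δ := fun p q r => by
    have h1 := hδ.four_point x (h ^ (p + q) • x) (h ^ p • x) (h ^ (p + q + r) • x)
    rw [dist_comm (h ^ (p + q) • x) (h ^ p • x), hd p q, hd (p + q) r] at h1
    have e : dist (h ^ p • x) (h ^ (p + q + r) • x) = a (q + r) := by rw [add_assoc, hd]
    rw [e, add_comm (dist x (h ^ (p + q + r) • x))] at h1
    exact h1
  obtain ⟨D, hD⟩ := quasi_superadditive hδ.1 hK (by simp [ha]) hsub hrev hlow hfp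
  obtain ⟨τ, hτ, hτa⟩ := exists_linear_growth hK (by simp [ha]) hsub (fun _ => dist_nonneg)
    hlow hD
  have hD0 : 0 ≤ D := by
    have := hτa 0
    simp only [Nat.cast_zero, mul_zero, zero_add] at this
    linarith
  refine ⟨τ, hτ, D, fun m n => ?_⟩
  wlog hmn : m ≤ n generalizing m n
  · have := this n m (le_of_not_ge hmn)
    rwa [dist_comm, abs_sub_comm]
  obtain ⟨k, rfl⟩ := Int.le.dest hmn
  have e : dist (h ^ m • x) (h ^ (m + (k : ℤ)) • x) = a k := by
    rw [zpow_add, mul_smul, dist_smul, zpow_natCast]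
  have := hτa k
  push_cast
  rw [e, sub_add_cancel_left, abs_neg, Nat.abs_cast]
  constructor <;> linarith

variable [Nonempty X] {h : Γ}

/-- The limit of `h ^ (e * n) • x` as `n → ∞`, for a sign `e`. -/
noncomputable def IsLoxodromic.limit (hh : IsLoxodromic X h) (e : ℤˣ) : Boundary X :=
  if e = 1 then hh.attractor else hh.repeller

lemma IsLoxodromic.limit_one (hh : IsLoxodromic X h) : hh.limit 1 = hh.attractor := if_pos rfl

lemma IsLoxodromic.limit_neg_one (hh : IsLoxodromic X h) : hh.limit (-1) = hh.repeller :=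
  if_neg (by decide)

lemma IsLoxodromic.limit_eq (hh : IsLoxodromic X h) (e : ℤˣ) (x : X) :
    ∃ hu, hh.limit e = Boundary.mk (fun n : ℕ => h ^ ((e : ℤ) * n) • x) hu := by
  rcases Int.units_eq_one_or e with rfl | rfl
  · have : (fun n : ℕ => h ^ (((1 : ℤˣ) : ℤ) * n) • x) = fun n : ℕ => h ^ n • x := by
      funext n
      rw [Units.val_one, one_mul, zpow_natCast]
    rw [this, hh.limit_one]
    exact ⟨hh.fellow x, hh.attractor_eq x⟩
  · have : (fun n : ℕ => h ^ (((-1 : ℤˣ) : ℤ) * n) • x) = fun n : ℕ => h⁻¹ ^ n • x := by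
      funext n
      rw [Units.val_neg, Units.val_one, neg_one_mul, zpow_neg, zpow_natCast, inv_pow]
    rw [this, hh.limit_neg_one]
    exact ⟨hh.inv.fellow x, hh.inv.attractor_eq x⟩

lemma IsLoxodromic.endpoints_eq (hh : IsLoxodromic X h) (e : ℤˣ) :
    hh.endpoints = {hh.limit (-e), hh.limit e} := by
  rcases Int.units_eq_one_or e with rfl | rfl
  · rw [hh.limit_one, hh.limit_neg_one]
    rfl
  · rw [neg_neg, hh.limit_one, hh.limit_neg_one, Set.pair_comm]
    rfl

lemma IsLoxodromic.repeller_ne_attractor (hh : IsLoxodromic X h) :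
    hh.repeller ≠ hh.attractor := by
  obtain ⟨x⟩ := ‹Nonempty X›
  obtain ⟨τ, hτ, D, hf⟩ := hh.exists_isRoughLine x
  obtain ⟨h1, e1⟩ := hh.limit_eq 1 x
  obtain ⟨h2, e2⟩ := hh.limit_eq (-1) x
  rw [← hh.limit_one, ← hh.limit_neg_one, e1, e2]
  intro heq
  refine hf.not_fellow_neg ?_
  simpa only [Units.val_neg, Units.val_one, one_mul, neg_one_mul] using
    (Boundary.mk_eq_mk.1 heq).symm

lemma IsLoxodromic.zpow_smul_limit (hh : IsLoxodromic X h) (n : ℤ) (e : ℤˣ) :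
    h ^ n • hh.limit e = hh.limit e := by
  obtain ⟨x⟩ := ‹Nonempty X›
  obtain ⟨hu, hx⟩ := hh.limit_eq e x
  obtain ⟨hv, hy⟩ := hh.limit_eq e (h ^ n • x)
  nth_rw 1 [hx]
  rw [hy, Boundary.smul_mk, Boundary.mk_eq_mk]
  have : (fun k : ℕ => h ^ n • h ^ ((e : ℤ) * k) • x) =
      fun k : ℕ => h ^ ((e : ℤ) * k) • h ^ n • x := by
    funext k
    rw [smul_smul, smul_smul, ← zpow_add, ← zpow_add, add_comm]
  rw [this]
  exact hv

lemma IsLoxodromic.zpow_smul_endpoints (hh : IsLoxodromic X h) (n : ℤ) :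
    h ^ n • hh.endpoints = hh.endpoints := by
  rw [hh.endpoints_eq 1, smul_pair, hh.zpow_smul_limit, hh.zpow_smul_limit]

lemma IsLoxodromic.sameCoset_iff (hh : IsLoxodromic X h) (g g' : Γ) :
    hh.SameCoset g g' ↔
      g • hh.repeller = g' • hh.repeller ∧ g • hh.attractor = g' • hh.attractor := by
  unfold IsLoxodromic.SameCoset
  rw [QuotientGroup.eq, MulAction.mem_stabilizer_iff, mul_smul, inv_smul_eq_iff,
    IsLoxodromic.endpointPair, Prod.smul_mk, Prod.smul_mk, Prod.mk.injEq]
  exact and_congr eq_comm eq_comm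

/-- Powers of `h` fix both endpoints, so parameters along the orbit may be shifted without changing
the coset. -/
lemma IsLoxodromic.sameCoset_mul_zpow (hh : IsLoxodromic X h) (g g' : Γ) (n : ℤ) :
    hh.SameCoset g (g' * h ^ n) ↔ hh.SameCoset g g' := by
  rw [hh.sameCoset_iff, hh.sameCoset_iff, mul_smul, mul_smul, ← hh.limit_one,
    ← hh.limit_neg_one, hh.zpow_smul_limit, hh.zpow_smul_limit]

/-- An element moving a long segment of the orbit of `h` to another one by a bounded amount moves
the endpoint of `h` only slightly. -/
lemma IsLoxodromic.eventually_smul_limit_mem (hh : IsLoxodromic X h) (x : X) (R : ℝ) (e : ℤˣ)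
    {V : Set (Boundary X)} (hV : V ∈ 𝓝 (hh.limit e)) :
    ∀ᶠ N : ℕ in atTop, ∀ (k : Γ) (e' : ℤˣ), dist (k • x) x ≤ R →
      dist (k • h ^ ((e' : ℤ) * N) • x) (h ^ ((e : ℤ) * N) • x) ≤ R → k • hh.limit e' ∈ V := by
  obtain ⟨δ, hδ⟩ := exists_isHyperbolicConst X
  obtain ⟨τ, hτ, D, hf⟩ := hh.exists_isRoughLine x
  obtain ⟨r, -, hr⟩ := (Boundary.nhds_hasBasis x (hh.limit e)).mem_iff.1 hV
  obtain ⟨N₀, hN₀⟩ := exists_nat_ge ((r + (3 / 2 * D + R + 2 * δ)) / τ)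
  rw [div_le_iff₀ hτ] at hN₀
  filter_upwards [eventually_ge_atTop N₀] with N hN k e' h0 hNk
  obtain ⟨hu, hx⟩ := hh.limit_eq e x
  obtain ⟨hv, hy⟩ := hh.limit_eq e' x
  refine hr ⟨_, _, hu, hv.smul k, hx.symm, by rw [hy]; rfl,
    eventually_atTop.2 ⟨(N, N), fun a ha => ?_⟩⟩
  have h1 := ((hf.unit_mul e').smul k).le_gromovProduct_of_close (hf.unit_mul e) hτ hδ
    (R := R) (N := N) (by simpa using h0) hNk ha.2 ha.1
  have h2 : (N₀ : ℝ) * τ ≤ N * τ := by gcongr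
  rw [gromovProduct_comm]
  simp only [mul_zero, zpow_zero, one_smul] at h1
  linarith

lemma IsLoxodromic.eventually_smul_limits_mem (hh : IsLoxodromic X h) (x : X) (R : ℝ)
    {U V : Set (Boundary X)} (hU : U ∈ 𝓝 hh.repeller) (hV : V ∈ 𝓝 hh.attractor) :
    ∀ᶠ N : ℕ in atTop, ∀ (k : Γ) (e : ℤˣ),
      (∀ n : ℤ, |n| ≤ N → dist (k • h ^ ((e : ℤ) * n) • x) (h ^ n • x) ≤ R) →
      k • hh.limit (-e) ∈ U ∧ k • hh.limit e ∈ V := by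
  rw [← hh.limit_one] at hV
  rw [← hh.limit_neg_one] at hU
  filter_upwards [hh.eventually_smul_limit_mem x R _ hU, hh.eventually_smul_limit_mem x R _ hV]
    with N h1 h2 k e hk
  have h0 : dist (k • x) x ≤ R := by simpa using hk 0 (by simp)
  refine ⟨h1 k (-e) h0 ?_, h2 k e h0 ?_⟩
  · simpa using hk (-N) (by simp)
  · simpa using hk N (by simp)

/-- The form in which isolation is applied. The threshold for `N` depends on `R` but not on `k`, and
the sign `e` allows `k` to reverse the direction. -/
lemma IsLoxodromic.eventually_smul_endpoints_eq (hh : IsLoxodromic X h)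
    (hiso : UnorderedIsolated Γ hh.repeller hh.attractor) (x : X) (R : ℝ) :
    ∀ᶠ N : ℕ in atTop, ∀ (k : Γ) (e : ℤˣ),
      (∀ n : ℤ, |n| ≤ N → dist (k • h ^ ((e : ℤ) * n) • x) (h ^ n • x) ≤ R) →
      k • hh.endpoints = hh.endpoints := by
  obtain ⟨U, hU, V, hV, hUV⟩ := hiso
  filter_upwards [hh.eventually_smul_limits_mem x R hU hV] with N hN k e hk
  refine hUV k ?_
  obtain ⟨h1, h2⟩ := hN k e hk
  rcases Int.units_eq_one_or e with rfl | rfl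
  · rw [hh.limit_one] at h2
    rw [hh.limit_neg_one] at h1
    exact Or.inl ⟨h1, h2⟩
  · rw [neg_neg, hh.limit_one] at h1
    rw [hh.limit_neg_one] at h2
    exact Or.inr ⟨h2, h1⟩

/-- An element that sends an endpoint of `h` to an endpoint stabilizes the set of endpoints, if
that set is isolated in its orbit. -/
lemma IsLoxodromic.smul_endpoints_eq_of_smul_limit_eq (hh : IsLoxodromic X h)
    (hiso : UnorderedIsolated Γ hh.repeller hh.attractor) {k : Γ} {e e' : ℤˣ}
    (hk : k • hh.limit e = hh.limit e') : k • hh.endpoints = hh.endpoints := by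
  obtain ⟨x⟩ := ‹Nonempty X›
  obtain ⟨δ, hδ⟩ := exists_isHyperbolicConst X
  obtain ⟨τ, hτ, D, hf⟩ := hh.exists_isRoughLine x
  obtain ⟨hu, hx⟩ := hh.limit_eq e x
  obtain ⟨hv, hy⟩ := hh.limit_eq e' x
  rw [hx, hy, Boundary.smul_mk, Boundary.mk_eq_mk] at hk
  obtain ⟨R, hR⟩ := ((hf.unit_mul e).smul k).exists_dist_le_of_fellow (hf.unit_mul e') hτ hδ hk
  obtain ⟨N, hN⟩ := (hh.eventually_smul_endpoints_eq hiso x R).exists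
  -- Recentring both rays at parameter `N` puts the whole window `|n| ≤ N` on their forward halves,
  -- where the bound `R` holds.
  have h1 := hN (h ^ (-((e' : ℤ) * N)) * k * h ^ ((e : ℤ) * N)) (e * e') fun n hn => by
    obtain ⟨m, hm⟩ : ∃ m : ℕ, (m : ℤ) = N + (e' : ℤ) * n := by
      refine ⟨(N + (e' : ℤ) * n).toNat, ?_⟩
      rw [abs_le] at hn
      rcases Int.units_eq_one_or e' with rfl | rfl
      · rw [Units.val_one]; omega
      · rw [Units.val_neg, Units.val_one]; omega
    have h2 := hR m
    have e1 : (h ^ (-((e' : ℤ) * N)) * k * h ^ ((e : ℤ) * N)) •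
        h ^ (((e * e' : ℤˣ) : ℤ) * n) • x =
        h ^ (-((e' : ℤ) * N)) • k • h ^ ((e : ℤ) * m) • x := by
      rw [mul_smul, mul_smul, smul_smul (h ^ ((e : ℤ) * N)), ← zpow_add, hm, Units.val_mul]
      congr 4
      ring
    have e2 : h ^ n • x = h ^ (-((e' : ℤ) * N)) • h ^ ((e' : ℤ) * m) • x := by
      rw [smul_smul, ← zpow_add, hm]
      congr 2
      have : (e' : ℤ) * e' = 1 := by
        rw [← Units.val_mul, Int.units_mul_self, Units.val_one]
      linear_combination (-n) * this
    rw [e1, e2, dist_smul]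
    exact h2
  rw [mul_smul, mul_smul, hh.zpow_smul_endpoints, zpow_neg, inv_smul_eq_iff,
    hh.zpow_smul_endpoints] at h1
  exact h1

end Loxodromic

/-! ### Quasi-axes, closest points and change of base point -/

section Orbits

variable {X Γ : Type*} [Group Γ] [MulAction Γ X] {h : Γ}

lemma IsQuasiAxis.apply_add_zsmul {γ : ℝ → X} {T : ℝ} (hT : ∀ t, γ (t + T) = h • γ t) (t : ℝ)
    (n : ℤ) : γ (t + n * T) = h ^ n • γ t := by
  induction n using Int.induction_on with
  | zero => simp
  | succ n ih =>
    rw [zpow_add_one, (Commute.self_zpow h n).symm.eq, mul_smul, ← ih, ← hT]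
    congr 1
    push_cast
    ring
  | pred n ih =>
    rw [zpow_sub_one, ← (Commute.inv_left (Commute.self_zpow h (-n))).eq, mul_smul, ← ih,
      eq_inv_smul_iff, ← hT]
    congr 1
    push_cast
    ring

variable [MetricSpace X]

/-- The orbit of a point, parametrized by a step function, is a quasi-axis. -/
lemma IsLoxodromic.isQuasiAxis_floor (hh : IsLoxodromic X h) (x : X) :
    IsQuasiAxis h fun t : ℝ => h ^ ⌊t⌋ • x := by
  obtain ⟨K, C, hK, hC, hQ⟩ := hh x
  refine ⟨⟨K, C + K, hK, by linarith, fun s t => ?_⟩, 1, one_pos, fun t => ?_⟩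
  · obtain ⟨h1, h2⟩ := hQ ⌊s⌋ ⌊t⌋
    have h3 : |dist ⌊s⌋ ⌊t⌋ - dist s t| ≤ 1 := by
      rw [Int.dist_eq, Real.dist_eq]
      refine (abs_abs_sub_abs_le _ _).trans ?_
      have := Int.floor_le s
      have := Int.floor_le t
      have := Int.lt_floor_add_one s
      have := Int.lt_floor_add_one t
      rw [abs_le]
      constructor <;> linarith
    rw [abs_le] at h3
    constructor
    · refine le_trans ?_ h1
      have h4 : dist s t / K ≤ (dist ⌊s⌋ ⌊t⌋ + 1) / K := by
        gcongr
        linarith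
      have h5 : 1 / K ≤ K := by
        rw [div_le_iff₀ (by linarith)]
        nlinarith
      rw [add_div] at h4
      linarith
    · refine h2.trans ?_
      have : K * dist ⌊s⌋ ⌊t⌋ ≤ K * (dist s t + 1) := by
        gcongr
        linarith
      linarith
  · dsimp only
    rw [Int.floor_add_one, add_comm, zpow_one_add, mul_smul]

/-- Closest points exist on orbits of loxodromic isometries. -/
lemma IsLoxodromic.exists_closest_point (hh : IsLoxodromic X h) (x y : X) :
    ∃ n : ℤ, ∀ m : ℤ, dist y (h ^ n • x) ≤ dist y (h ^ m • x) := by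
  obtain ⟨K, C, hK, -, hQ⟩ := hh x
  -- Only these exponents compete for the minimum, and the lower quasi-isometry bound makes them
  -- finite in number.
  set S := {n : ℤ | dist y (h ^ n • x) ≤ dist y (h ^ (0 : ℤ) • x)} with hS
  have hfin : S.Finite := by
    refine (Metric.isCompact_of_isClosed_isBounded (isClosed_discrete S)
      (Metric.isBounded_iff.2 ⟨K * (2 * dist y (h ^ (0 : ℤ) • x) + C), fun m hm n hn => ?_⟩)).finite_of_discrete
    have h1 := (hQ m n).1
    have h2 := dist_triangle_left (h ^ m • x) (h ^ n • x) y
    have hm' : dist y (h ^ m • x) ≤ _ := hm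
    have hn' : dist y (h ^ n • x) ≤ _ := hn
    have h3 : dist m n / K ≤ 2 * dist y (h ^ (0 : ℤ) • x) + C := by
      dsimp only at h1
      linarith
    rw [div_le_iff₀ (by linarith)] at h3
    linarith
  obtain ⟨n, hn, hmin⟩ := Set.exists_min_image S (fun n => dist y (h ^ n • x)) hfin
    ⟨0, le_refl (dist y (h ^ (0 : ℤ) • x))⟩
  refine ⟨n, fun m => ?_⟩
  by_cases hm : m ∈ S
  · exact hmin m hm
  · have hm' : dist y (h ^ (0 : ℤ) • x) < dist y (h ^ m • x) := not_le.1 hm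
    exact le_trans hn hm'.le

variable [IsIsometricSMul Γ X]

/-- A quasi-axis is at bounded distance from an orbit, which it contains. -/
lemma IsQuasiAxis.exists_near_orbit {γ : ℝ → X} (hγ : IsQuasiAxis h γ) :
    ∃ C, 0 ≤ C ∧ (∀ n : ℤ, h ^ n • γ 0 ∈ Set.range γ) ∧
      ∀ y ∈ Set.range γ, ∃ n : ℤ, dist y (h ^ n • γ 0) ≤ C := by
  obtain ⟨⟨K, C, hK, hC, hQ⟩, T, hT0, hT⟩ := hγ
  refine ⟨K * T + C, by positivity, fun n => ⟨0 + n * T, ?_⟩, ?_⟩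
  · exact IsQuasiAxis.apply_add_zsmul hT 0 n
  · rintro _ ⟨t, rfl⟩
    refine ⟨⌊t / T⌋, ?_⟩
    have e : t = (t - ⌊t / T⌋ * T) + ⌊t / T⌋ * T := by ring
    have h1 : 0 ≤ t - ⌊t / T⌋ * T := by
      have := Int.floor_le (t / T)
      rw [le_div_iff₀ hT0] at this
      linarith
    have h2 : t - ⌊t / T⌋ * T ≤ T := by
      have := (Int.lt_floor_add_one (t / T)).le
      rw [div_le_iff₀ hT0] at this
      linarith
    nth_rw 1 [e]
    rw [IsQuasiAxis.apply_add_zsmul hT, dist_smul]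
    refine (hQ _ _).2.trans ?_
    rw [Real.dist_eq, sub_zero, abs_of_nonneg h1]
    gcongr

lemma MovesRayBoundedly.of_point {g : ℕ → Γ} {x : X} (hx : MovesRayBoundedly h g x) (y : X) :
    MovesRayBoundedly h g y := by
  obtain ⟨R, hR, hmove⟩ := hx
  refine ⟨R + 2 * dist x y, by positivity, fun M => ?_⟩
  obtain ⟨I, hI⟩ := hmove M
  refine ⟨I, fun m i hm hi => ?_⟩
  have h1 := hI m i hm hi
  have h2 := dist_triangle4 (g i • h ^ m • y) (g i • h ^ m • x) (h ^ m • x) (h ^ m • y)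
  simp only [dist_smul] at h2
  rw [dist_comm y x] at h2
  linarith

lemma IsLoxodromic.conj (hh : IsLoxodromic X h) (k : Γ) : IsLoxodromic X (k * h * k⁻¹) := by
  intro x
  obtain ⟨K, C, hK, hC, hQ⟩ := hh (k⁻¹ • x)
  refine ⟨K, C, hK, hC, fun s t => ?_⟩
  have := hQ s t
  simpa only [conj_zpow, mul_smul, dist_smul] using this

end Orbits

/-! ### The implications between the conditions -/

section Equivalences

variable {X : Type*} [MetricSpace X] [GromovHyperbolic X] [Nonempty X]
  {Γ : Type*} [Group Γ] [MulAction Γ X] [IsIsometricSMul Γ X] {h : Γ}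

lemma IsLoxodromic.SameCoset.symm {hh : IsLoxodromic X h} {g g' : Γ} (hg : hh.SameCoset g g') :
    hh.SameCoset g' g :=
  Eq.symm hg

/-- Greedy choice, avoiding the cosets already used. The index `N` is recorded with each element and
made strictly increasing, which yields `N ≥ i`. -/
lemma IsLoxodromic.exists_seq_not_sameCoset (hh : IsLoxodromic X h) {S : ℕ → Γ → Prop}
    (hS : ∀ (N : ℕ) (F : Finset Γ), ∃ g, S N g ∧ ∀ f ∈ F, ¬ hh.SameCoset f g) :
    ∃ g : ℕ → Γ, (∀ i j, i ≠ j → ¬ hh.SameCoset (g i) (g j)) ∧ ∀ i, ∃ N ≥ i, S N (g i) := by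
  classical
  obtain ⟨f, hf, hr⟩ := exists_seq_of_forall_finset_exists (fun a : Γ × ℕ => S a.2 a.1)
    (fun a b => ¬ hh.SameCoset a.1 b.1 ∧ a.2 < b.2) fun s _ => by
      obtain ⟨g, hg, hgF⟩ := hS (s.sup Prod.snd + 1) (s.image Prod.fst)
      exact ⟨(g, s.sup Prod.snd + 1), hg, fun a ha => ⟨hgF _ (Finset.mem_image_of_mem _ ha),
        Nat.lt_succ_of_le (Finset.le_sup (f := Prod.snd) ha)⟩⟩
  refine ⟨fun n => (f n).1, fun i j hij => ?_, fun i => ⟨(f i).2, ?_, hf i⟩⟩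
  · rcases lt_or_gt_of_ne hij with hlt | hlt
    · exact (hr _ _ hlt).1
    · exact fun hs => (hr _ _ hlt).1 hs.symm
  · exact (strictMono_nat_of_lt_succ fun n => (hr n (n + 1) n.lt_succ_self).2).le_apply

/-- If `∂_±h` is not isolated in its orbit, then there are elements in different cosets that move
long initial segments of an orbit of `h` by a bounded amount. -/
lemma IsLoxodromic.exists_seq_of_not_orderedIsolated (hh : IsLoxodromic X h)
    (hiso : ¬ OrderedIsolated Γ hh.repeller hh.attractor) (x : X) :
    ∃ g : ℕ → Γ, (∀ i j, i ≠ j → ¬ hh.SameCoset (g i) (g j)) ∧ MovesRayBoundedly h g x := by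
  classical
  obtain ⟨δ, hδ⟩ := exists_isHyperbolicConst X
  obtain ⟨τ, hτ, D, hf⟩ := hh.exists_isRoughLine x
  have hD := hf.error_nonneg
  set C := 5 * D + 3 * (7 / 2 * D + τ + 4 * δ) + 4 * δ with hC
  obtain ⟨g, hg, hgS⟩ := hh.exists_seq_not_sameCoset
    (S := fun N g => ∀ n : ℕ, n ≤ N → dist (g • h ^ n • x) (h ^ n • x) ≤ C) (by
    intro N F
    -- The last `2δ` pays for passing to the orbit representatives of the endpoints.
    set r := max (3 / 2 * D + 2 * δ + 1) (τ * N) + 2 * δ with hr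
    -- Deleting the finitely many images `f • ξ ≠ ξ` with `f ∈ F` ensures that a `g` in the coset of
    -- some such `f` and moving both endpoints into these sets must fix both.
    have hexcl : ∀ ξ : Boundary X,
        Boundary.nhd x ξ r ∩ (((F.image (· • ξ)).erase ξ : Finset (Boundary X)) :
          Set (Boundary X))ᶜ ∈ 𝓝 ξ := fun ξ =>
      inter_mem (Boundary.nhd_mem_nhds x ξ r)
        ((Finset.finite_toSet _).isClosed.isOpen_compl.mem_nhds (by simp))
    obtain ⟨g, hga, hgb, hgne⟩ : ∃ g : Γ, _ ∧ _ ∧ _ := by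
      by_contra! hcon
      exact hiso ⟨_, hexcl _, _, hexcl _, fun g h1 h2 => by
        by_contra hne
        exact hcon g h1 h2 hne⟩
    have hcoset : ∀ f ∈ F, ¬ hh.SameCoset f g := by
      intro f hf hs
      obtain ⟨e1, e2⟩ := (hh.sameCoset_iff f g).1 hs
      have key : ∀ ξ : Boundary X, f • ξ = g • ξ →
          g • ξ ∈ (((F.image (· • ξ)).erase ξ : Finset (Boundary X)) : Set (Boundary X))ᶜ →
          g • ξ = ξ := fun ξ he hm => by
        by_contra hne
        exact hm (Finset.mem_coe.2 (Finset.mem_erase.2 ⟨hne, he ▸ Finset.mem_image_of_mem _ hf⟩))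
      exact hgne ⟨key _ e1 hga.2, key _ e2 hgb.2⟩
    obtain ⟨hu, hx⟩ := hh.limit_eq 1 x
    obtain ⟨hv, hy⟩ := hh.limit_eq (-1) x
    have ha := hga.1
    have hb := hgb.1
    rw [← hh.limit_neg_one, hy, Boundary.smul_mk] at ha
    rw [← hh.limit_one, hx, Boundary.smul_mk] at hb
    have ha' := Boundary.eventually_of_mem_nhd hδ ha
    have hb' := Boundary.eventually_of_mem_nhd hδ hb
    have hswap : Tendsto (Prod.swap : ℕ × ℕ → ℕ × ℕ) atTop atTop := by
      rw [← prod_atTop_atTop_eq]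
      exact tendsto_snd.prodMk tendsto_fst
    obtain ⟨s, hs⟩ := (hf.smul g).exists_shift_dist_le hf hτ hδ
      (r := max (3 / 2 * D + 2 * δ + 1) (τ * N)) (N := N)
      ((lt_add_one _).trans_le (le_max_left _ _)) (le_max_right _ _)
      ((hswap.eventually hb').mono fun a ha => by
        simp only [Units.val_one, one_mul, Prod.fst_swap, Prod.snd_swap, hr,
          add_sub_cancel_right] at ha
        rwa [gromovProduct_comm, zpow_zero, one_smul])
      ((hswap.eventually ha').mono fun a ha => by
        simp only [Units.val_neg, Units.val_one, neg_one_mul, Prod.fst_swap, Prod.snd_swap, hr,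
          add_sub_cancel_right] at ha
        rwa [gromovProduct_comm, zpow_zero, one_smul])
    refine ⟨g * h ^ s, fun n hn => ?_, fun f hf => ?_⟩
    · have := hs n hn
      rw [mul_smul, ← zpow_natCast, smul_smul (h ^ s), ← zpow_add]
      exact this
    · rw [hh.sameCoset_mul_zpow]
      exact hcoset f hf)
  refine ⟨g, hg, C + 1, by have := hδ.1; positivity, fun M => ⟨M, fun m i hm hi => ?_⟩⟩
  obtain ⟨N, hN, hgN⟩ := hgS i
  have := hgN m (by omega)
  linarith

/-- Far apart closest points force `g(ℓ)` and `ℓ` to overlap along a segment long enough for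
isolation to put `g` in `Stab(∂h)`. -/
lemma IsLoxodromic.hasBoundedProjections (hh : IsLoxodromic X h)
    (hiso : UnorderedIsolated Γ hh.repeller hh.attractor) : hh.HasBoundedProjections := by
  intro γ hγ
  obtain ⟨C, hC, hmem, hnear⟩ := hγ.exists_near_orbit
  obtain ⟨δ, hδ⟩ := exists_isHyperbolicConst X
  obtain ⟨τ, hτ, D, hf⟩ := hh.exists_isRoughLine (γ 0)
  have hD := hf.error_nonneg
  have hδ0 := hδ.1
  set C' := 7 * C + 3 * (2 * D + τ + 2 * δ) + δ with hC'
  have hC'0 : 0 ≤ C' := by positivity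
  obtain ⟨N, hN⟩ := (hh.eventually_smul_endpoints_eq hiso (γ 0)
    (3 * C' + 6 * D + 2 * δ)).exists
  -- The sum of the thresholds of `exists_close_of_far_projections` and `exists_overlap`, plus `2C`
  -- for replacing closest points by orbit points. It does not depend on `g`.
  set B := 2 * (2 * C + (2 * D + τ + 2 * δ)) + δ + (τ * (2 * N) + 3 * D + 2 * C') + 2 * C with hB
  refine ⟨B, by positivity, fun g hg π hπ => ?_⟩
  have hpt : ∀ y ∈ g • Set.range γ, ∃ i j : ℤ, dist (π y) (h ^ i • γ 0) ≤ C ∧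
      dist y (g • h ^ j • γ 0) ≤ C ∧ ∀ n : ℤ, dist y (π y) ≤ dist y (h ^ n • γ 0) := by
    intro y hy
    obtain ⟨h1, h2⟩ := hπ y hy
    obtain ⟨i, hi⟩ := hnear _ h1
    obtain ⟨z, hz, rfl⟩ := hy
    obtain ⟨j, hj⟩ := hnear z hz
    exact ⟨i, j, hi, by simpa only [dist_smul] using hj, fun n => h2 _ (hmem n)⟩
  intro y hy y' hy'
  by_contra! hfar
  obtain ⟨i, j, hi, hj, hmin⟩ := hpt y hy
  obtain ⟨i', j', hi', hj', hmin'⟩ := hpt y' hy'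
  have hfar1 : 2 * (2 * C + (2 * D + τ + 2 * δ)) + δ < dist (π y) (π y') := by
    have : 0 ≤ τ * (2 * N) + 3 * D + 2 * C' + 2 * C := by positivity
    linarith
  obtain ⟨s, hs⟩ := hf.exists_close_of_far_projections (hf.smul g) hτ hδ hi hi' hj hj' hmin hmin'
    hfar1
  obtain ⟨s', hs'⟩ := hf.exists_close_of_far_projections (hf.smul g) hτ hδ hi' hi hj' hj hmin' hmin
    (by rwa [dist_comm])
  have hfar2 : τ * (2 * N) + 3 * D + 2 * C' ≤ dist (h ^ i • γ 0) (h ^ i' • γ 0) := by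
    have h1 := dist_triangle4 (π y) (h ^ i • γ 0) (h ^ i' • γ 0) (π y')
    rw [dist_comm (h ^ i' • γ 0) (π y')] at h1
    have : 0 ≤ 2 * (2 * C + (2 * D + τ + 2 * δ)) + δ := by positivity
    linarith
  obtain ⟨e, a, b, hab⟩ : ∃ (e : ℤˣ) (a b : ℤ), ∀ n : ℤ, |n| ≤ N →
      dist (g • h ^ (b + e * n) • γ 0) (h ^ (a + n) • γ 0) ≤ 3 * C' + 6 * D + 2 * δ := by
    rcases le_total i i' with hii | hii
    · exact hf.exists_overlap (hf.smul g) hτ hδ hii hs hs' hfar2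
    · exact hf.exists_overlap (hf.smul g) hτ hδ hii hs' hs (by rwa [dist_comm])
  refine hg (MulAction.mem_stabilizer_iff.2 ?_)
  have h1 := hN (h ^ (-a) * g * h ^ b) e fun n hn => by
    have h2 := hab n hn
    rw [← dist_smul (h ^ (-a)), smul_smul (h ^ (-a)) (h ^ (a + n)), ← zpow_add,
      neg_add_cancel_left, zpow_add, mul_smul (h ^ b)] at h2
    rwa [mul_smul, mul_smul]
  rw [mul_smul, mul_smul, hh.zpow_smul_endpoints, zpow_neg, inv_smul_eq_iff,
    hh.zpow_smul_endpoints] at h1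
  exact h1

/-- Each element fixes or swaps the two endpoints, so `Stab(∂h)` contains at most two cosets of
`Stab(∂_±h)`. -/
lemma IsLoxodromic.sameCoset_of_mem_stabilizer (hh : IsLoxodromic X h) {g₀ g₁ g₂ : Γ}
    (h₀ : g₀ ∈ MulAction.stabilizer Γ hh.endpoints) (h₁ : g₁ ∈ MulAction.stabilizer Γ hh.endpoints)
    (h₂ : g₂ ∈ MulAction.stabilizer Γ hh.endpoints) :
    hh.SameCoset g₀ g₁ ∨ hh.SameCoset g₀ g₂ ∨ hh.SameCoset g₁ g₂ := by
  have key : ∀ g ∈ MulAction.stabilizer Γ hh.endpoints,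
      g • hh.repeller = hh.repeller ∧ g • hh.attractor = hh.attractor ∨
      g • hh.repeller = hh.attractor ∧ g • hh.attractor = hh.repeller := fun g hg => by
    rw [MulAction.mem_stabilizer_iff, IsLoxodromic.endpoints, smul_pair] at hg
    exact Set.pair_eq_pair_iff.1 hg
  simp only [hh.sameCoset_iff]
  rcases key _ h₀ with ⟨a, b⟩ | ⟨a, b⟩ <;> rcases key _ h₁ with ⟨c, d⟩ | ⟨c, d⟩ <;>
    rcases key _ h₂ with ⟨e, f⟩ | ⟨e, f⟩ <;> simp [a, b, c, d, e, f]

/-- If `g i` moves `x` and `h ^ M • x` by less than `R`, the closest points of their images are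
within `2R` of `x` and `h ^ M • x`, hence about `τM` apart; a large `M` exceeds the bound. -/
lemma IsLoxodromic.HasBoundedProjections.not_exists_seq {hh : IsLoxodromic X h}
    (hbdd : hh.HasBoundedProjections) :
    ¬ ∃ g : ℕ → Γ, (∀ i j, i ≠ j → ¬ hh.SameCoset (g i) (g j)) ∧
        ∃ x : X, MovesRayBoundedly h g x := by
  rintro ⟨g, hg, x, R, hR, hmove⟩
  obtain ⟨τ, hτ, D, hf⟩ := hh.exists_isRoughLine x
  obtain ⟨B, hB, hbound⟩ := hbdd _ (hh.isQuasiAxis_floor x)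
  have hrange : ∀ n : ℤ, h ^ n • x ∈ Set.range fun t : ℝ => h ^ ⌊t⌋ • x := fun n =>
    ⟨n, by simp⟩
  obtain ⟨M, hM⟩ := exists_nat_gt ((B + 4 * R + D) / τ)
  rw [div_lt_iff₀ hτ] at hM
  obtain ⟨I, hI⟩ := hmove M
  obtain ⟨i, hi, hgi⟩ : ∃ i ≥ I, g i ∉ MulAction.stabilizer Γ hh.endpoints := by
    by_contra! hcon
    rcases hh.sameCoset_of_mem_stabilizer (hcon I le_rfl) (hcon (I + 1) (by omega))
      (hcon (I + 2) (by omega)) with h1 | h1 | h1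
    · exact hg _ _ (by omega) h1
    · exact hg _ _ (by omega) h1
    · exact hg _ _ (by omega) h1
  choose n hn using hh.exists_closest_point x
  have h1 := hbound (g i) hgi (fun y => h ^ n y • x) (by
    refine fun y _ => ⟨hrange _, ?_⟩
    rintro _ ⟨t, rfl⟩
    exact hn y ⌊t⌋) (g i • h ^ (0 : ℤ) • x) (Set.smul_mem_smul_set (hrange 0))
    (g i • h ^ (M : ℤ) • x) (Set.smul_mem_smul_set (hrange M))
  have hclose : ∀ m : ℕ, m ≤ M → dist (h ^ (m : ℤ) • x) (h ^ n (g i • h ^ (m : ℤ) • x) • x)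
      ≤ 2 * R := fun m hm => by
    have h2 := hI m i hm hi
    rw [← zpow_natCast] at h2
    have h3 := hn (g i • h ^ (m : ℤ) • x) m
    have h4 := dist_triangle_left (h ^ (m : ℤ) • x) (h ^ n (g i • h ^ (m : ℤ) • x) • x)
      (g i • h ^ (m : ℤ) • x)
    linarith
  have h2 := hclose 0 (Nat.zero_le _)
  have h3 := hclose M le_rfl
  have h4 := (hf 0 M).1
  simp only [Int.cast_zero, Int.cast_natCast, zero_sub, abs_neg, Nat.abs_cast] at h4
  rw [Nat.cast_zero] at h2
  rw [dist_comm] at h3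
  have h5 := dist_triangle4 (h ^ (0 : ℤ) • x) (h ^ n (g i • h ^ (0 : ℤ) • x) • x)
    (h ^ n (g i • h ^ (M : ℤ) • x) • x) (h ^ (M : ℤ) • x)
  linarith

lemma IsWWPD.not_exists_seq (hw : IsWWPD X h) (hh : IsLoxodromic X h) :
    ¬ ∃ g : ℕ → Γ, (∀ i j, i ≠ j → ¬ hh.SameCoset (g i) (g j)) ∧
        ∃ x : X, MovesRayBoundedly h g x := by
  rintro ⟨g, hg, x, R, hR, hmove⟩
  obtain ⟨hh', hw⟩ := hw
  obtain ⟨M, -, hM⟩ := hw x R hR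
  obtain ⟨I, hI⟩ := hmove M
  have hinj : Function.Injective g := fun i j hij => by
    by_contra hne
    exact hg i j hne (hij ▸ rfl)
  refine (Set.Ici_infinite I).image hinj.injOn (hM (g '' Set.Ici I) ?_ ?_)
  · rintro _ ⟨i, hi, rfl⟩
    constructor
    · rw [dist_comm]
      simpa using hI 0 i (Nat.zero_le _) hi
    · rw [dist_comm]
      exact hI M i le_rfl hi
  · rintro _ ⟨i, -, rfl⟩ _ ⟨j, -, rfl⟩ hne
    exact hg i j fun hij => hne (congrArg g hij)

/-- Failure of WWPD supplies, for each exponent, infinitely many cosets of elements moving both ends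
of the orbit segment by less than `R`. The points in between then move by a bounded amount too. -/
lemma IsLoxodromic.isWWPD (hh : IsLoxodromic X h)
    (hseq : ¬ ∃ g : ℕ → Γ, (∀ i j, i ≠ j → ¬ hh.SameCoset (g i) (g j)) ∧
        ∀ x : X, MovesRayBoundedly h g x) : IsWWPD X h := by
  refine ⟨hh, fun x R hR => ?_⟩
  by_contra! hcon
  obtain ⟨δ, hδ⟩ := exists_isHyperbolicConst X
  obtain ⟨τ, hτ, D, hf⟩ := hh.exists_isRoughLine x
  have hD := hf.error_nonneg
  have hδ0 := hδ.1
  obtain ⟨g, hg, hgS⟩ := hh.exists_seq_not_sameCoset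
    -- The exponent is `N + 1` because WWPD asks for `1 ≤ M`.
    (S := fun N g => dist x (g • x) < R ∧ dist (h ^ (N + 1) • x) (g • h ^ (N + 1) • x) < R) (by
    intro N F
    obtain ⟨Z, hZ, hZc, hZinf⟩ := hcon (N + 1) (by omega)
    by_contra! hno
    refine hZinf ((F.finite_toSet.biUnion (t := fun f => {g ∈ Z | hh.SameCoset f g})
      fun f _ => Set.Subsingleton.finite ?_).subset fun g hgZ => ?_)
    · rintro a ⟨ha, ha'⟩ b ⟨hb, hb'⟩
      by_contra hne
      exact hZc a ha b hb hne (ha'.symm.trans hb')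
    · obtain ⟨f, hfF, hfg⟩ := hno g (hZ g hgZ)
      exact Set.mem_biUnion hfF ⟨hgZ, hfg⟩)
  refine hseq ⟨g, hg, MovesRayBoundedly.of_point (x := x) ⟨R + 3 * D + 2 * δ + 1, by positivity,
    fun M => ⟨M, fun m i hm hi => ?_⟩⟩⟩
  obtain ⟨N, hN, h0, h1⟩ := hgS i
  have := (hf.smul (g i)).dist_le_of_mem hf hδ (R := R) (i := 0) (m := m) (N := N + 1)
    (by rw [dist_comm]; simpa using h0.le)
    (by rw [dist_comm, zero_add]; simpa only [zpow_natCast] using h1.le) (by omega)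
  simp only [zero_add, zpow_natCast] at this
  linarith

lemma IsLoxodromic.attractor_conj (hh : IsLoxodromic X h) {k h' : Γ} (hh' : IsLoxodromic X h')
    (he : h' = k * h * k⁻¹) : hh'.attractor = k • hh.attractor := by
  obtain ⟨x⟩ := ‹Nonempty X›
  rw [hh'.attractor_eq (k • x), hh.attractor_eq x, Boundary.smul_mk]
  congr 1
  funext n
  rw [he, conj_pow, mul_smul, mul_smul, inv_smul_smul]

lemma IsLoxodromic.endpoints_conj (hh : IsLoxodromic X h) (k : Γ) :
    (hh.conj k).endpoints = k • hh.endpoints := by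
  rw [IsLoxodromic.endpoints, IsLoxodromic.endpoints, smul_pair, hh.attractor_conj _ rfl]
  congr 1
  exact hh.inv.attractor_conj (hh.conj k).inv (by group)

end Equivalences

end WWPD

/-! ### The main theorem -/

theorem mainTheorem6 {X : Type*} [MetricSpace X] [WWPD.GromovHyperbolic X] [Nonempty X]
    {Γ : Type*} [Group Γ] [MulAction Γ X] [IsIsometricSMul Γ X]
    (h : Γ) (hh : WWPD.IsLoxodromic X h) :
    List.TFAE [
      WWPD.IsWWPD X h,
      hh.HasEquivariantlyDiscreteFixedSet,
      hh.HasEquivariantlyDiscreteFixedPair,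
      hh.HasBoundedProjections,
      ¬ ∃ g : ℕ → Γ, (∀ i j, i ≠ j → ¬ hh.SameCoset (g i) (g j)) ∧
        ∀ x : X, WWPD.MovesRayBoundedly h g x,
      ¬ ∃ g : ℕ → Γ, (∀ i j, i ≠ j → ¬ hh.SameCoset (g i) (g j)) ∧
        ∃ x : X, WWPD.MovesRayBoundedly h g x] ∧
    (WWPD.IsWWPD X h →
      MulAction.stabilizer Γ hh.repeller = MulAction.stabilizer Γ hh.attractor ∧
      MulAction.stabilizer Γ hh.attractor = MulAction.stabilizer Γ hh.endpointPair ∧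
      ∀ k : Γ, k ∉ MulAction.stabilizer Γ hh.endpoints →
        WWPD.Independent X h (k * h * k⁻¹)) := by
  have hne := hh.repeller_ne_attractor
  have hset : hh.HasEquivariantlyDiscreteFixedSet ↔
      WWPD.UnorderedIsolated Γ hh.repeller hh.attractor :=
    (WWPD.unorderedIsolated_iff_isDiscrete hne).symm
  have hpair : hh.HasEquivariantlyDiscreteFixedPair ↔
      WWPD.OrderedIsolated Γ hh.repeller hh.attractor :=
    (WWPD.orderedIsolated_iff_isDiscrete hne).symm
  have htfae : List.TFAE [
      WWPD.IsWWPD X h,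
      hh.HasEquivariantlyDiscreteFixedSet,
      hh.HasEquivariantlyDiscreteFixedPair,
      hh.HasBoundedProjections,
      ¬ ∃ g : ℕ → Γ, (∀ i j, i ≠ j → ¬ hh.SameCoset (g i) (g j)) ∧
        ∀ x : X, WWPD.MovesRayBoundedly h g x,
      ¬ ∃ g : ℕ → Γ, (∀ i j, i ≠ j → ¬ hh.SameCoset (g i) (g j)) ∧
        ∃ x : X, WWPD.MovesRayBoundedly h g x] := by
    tfae_have 1 → 6 := fun hw => hw.not_exists_seq hh
    tfae_have 6 → 5 := fun h6 ⟨g, hg, hx⟩ => h6 ⟨g, hg, Classical.arbitrary X, hx _⟩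
    tfae_have 5 → 1 := hh.isWWPD
    tfae_have 6 → 3 := fun h6 => hpair.2 <| by
      by_contra hiso
      obtain ⟨g, hg, hx⟩ := hh.exists_seq_of_not_orderedIsolated hiso (Classical.arbitrary X)
      exact h6 ⟨g, hg, _, hx⟩
    tfae_have 3 → 2 := fun h3 => hset.2 (hpair.1 h3).unordered
    tfae_have 2 → 4 := fun h2 => hh.hasBoundedProjections (hset.1 h2)
    tfae_have 4 → 6 := fun h4 => h4.not_exists_seq
    tfae_finish
  refine ⟨htfae, fun hw => ?_⟩
  have hiso := hset.1 ((htfae.out 0 1).1 hw)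
  have hfix : ∀ (k : Γ) (e e' : ℤˣ), k • hh.limit e = hh.limit e' →
      k • hh.endpoints = hh.endpoints := fun k e e' =>
    hh.smul_endpoints_eq_of_smul_limit_eq hiso
  -- Fixing one endpoint forces `k` to preserve the pair; it cannot swap two distinct points while
  -- fixing one, so it fixes the other.
  have hiff : ∀ k : Γ, k • hh.repeller = hh.repeller ↔ k • hh.attractor = hh.attractor := by
    intro k
    have hpairs : k • hh.endpoints = hh.endpoints →
        k • hh.repeller = hh.repeller ∧ k • hh.attractor = hh.attractor ∨
        k • hh.repeller = hh.attractor ∧ k • hh.attractor = hh.repeller := fun he => by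
      rw [WWPD.IsLoxodromic.endpoints, WWPD.smul_pair] at he
      exact Set.pair_eq_pair_iff.1 he
    constructor
    · intro hk
      rcases hpairs (hfix k (-1) (-1) (by rwa [hh.limit_neg_one])) with h1 | h1
      · exact h1.2
      · exact absurd (hk.symm.trans h1.1) hne
    · intro hk
      rcases hpairs (hfix k 1 1 (by rwa [hh.limit_one])) with h1 | h1
      · exact h1.1
      · exact absurd (h1.2.symm.trans hk) hne
  refine ⟨?_, ?_, fun k hk => ⟨hh, hh.conj k, ?_⟩⟩
  · ext k
    rw [MulAction.mem_stabilizer_iff, MulAction.mem_stabilizer_iff, hiff]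
  · ext k
    rw [MulAction.mem_stabilizer_iff, MulAction.mem_stabilizer_iff,
      WWPD.IsLoxodromic.endpointPair, Prod.smul_mk, Prod.mk.injEq, hiff, and_self]
  -- The endpoints of the conjugate are the `k`-translates, so a common endpoint would be an
  -- endpoint of `h` that `k` sends to an endpoint of `h`.
  · rw [hh.endpoints_conj, Set.eq_empty_iff_forall_notMem]
    rintro ξ ⟨h1, η, h2, rfl⟩
    have hlim : ∀ ζ ∈ hh.endpoints, ∃ e, ζ = hh.limit e := by
      rintro ζ (rfl | rfl)
      · exact ⟨-1, hh.limit_neg_one.symm⟩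
      · exact ⟨1, hh.limit_one.symm⟩
    obtain ⟨e, rfl⟩ := hlim η h2
    obtain ⟨e', he'⟩ := hlim _ h1
    exact hk (hfix k e e' he')
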